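/- Let $\alpha>0$ and let $\Theta=(\theta_k)_{k\ge1}$ be real numbers with $\theta_k\ge 0$ for all $k\ge 1$ and $\theta_k\sim k^\alpha$ as $k\to\infty$. For $\sigma\in\mathfrak S_n$ let $C_k(\sigma)$ be the number of cycles of length $k$ (fixed points are cycles of length $1$) and let $L_j(\sigma)$, $j\ge1$, be the length of the $j$-th longest cycle of $\sigma$, counted with multiplicity (and $0$ if $\sigma$ has fewer than $j$ cycles). Let $\mathbb P_\Theta$ be the measure on $\mathfrak S_n$ given by $$\mathbb P_\Theta[\sigma]=\frac1{h_n\,n!}\prod_{k=1}^n\theta_k^{C_k(\sigma)},\qquad h_n=\frac1{n!}\sum_{\sigma\in\mathfrak S_n}\prod_{k=1}^n\theta_k^{C_k(\sigma)}.$$ For every $n\ge1$ the equation $\sum_{k=1}^\infty\theta_k e^{-kv}=n$ has exactly one solution $v=v_n>0$. Put $$n^*:=\frac1{v_n},\qquad \ell_n:=\alpha\log(n^*)+(\alpha-1)\log\bigl(\alpha\log(n^*)\bigr).$$ Then $n^*\sim\bigl(n/\Gamma(\alpha+1)\bigr)^{1/(1+\alpha)}$ as $n\to\infty$. Moreover $\mathbb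 P_\Theta$ is a well-defined probability measure for all sufficiently large $n$ and, for every fixed $K\in\mathbb N$, under $\mathbb P_\Theta$ as $n\to\infty$, $$\frac1{n^*}\bigl(L_1-n^*\ell_n,\dots,L_K-n^*\ell_n\bigr)\ \xrightarrow{\;d\;}\ \Bigl(-\log(E_1),\,-\log(E_1+E_2),\,\dots,\,-\log\bigl(\textstyle\sum_{j=1}^K E_j\bigr)\Bigr),$$ where $E_1,\dots,E_K$ are independent $\mathrm{Exp}(1)$ random variables. In particular, the longest cycle has a Gumbel limit: for every $x\in\mathbb R$, $$\mathbb P_\Theta\Bigl[\frac{L_1-n^*\ell_n}{n^*}\le x\Bigr]\longrightarrow e^{-e^{-x}}.$$ -/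

import Mathlib

open MeasureTheory ProbabilityTheory Filter Topology
open scoped BigOperators Asymptotics

namespace LongCycles

noncomputable section

/-- The cycle count `C_m(σ)`: the number of cycles of length `m` of `σ`.  The parts of
`σ.partition` are the lengths of all cycles of `σ`, fixed points included (as parts `1`). -/
def cycleCount {n : ℕ} (m : ℕ) (σ : Equiv.Perm (Fin n)) : ℕ :=
  σ.partition.parts.count m

/-- `L_j(σ)` for `j ≥ 1`: the length of the `j`-th longest cycle of `σ`, counted with
multiplicity; it is `0` if `σ` has fewer than `j` cycles. -/
def longestCycle {n : ℕ} (j : ℕ) (σ : Equiv.Perm (Fin n)) : ℕ :=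
  (σ.partition.parts.sort (fun a b => a ≥ b)).getD (j - 1) 0

/-- The multiplicative weight `∏_{k=1}^n θ_k ^ C_k(σ)`. -/
def weight (θ : ℕ → ℝ) (n : ℕ) (σ : Equiv.Perm (Fin n)) : ℝ :=
  ∏ k ∈ Finset.Icc 1 n, θ k ^ cycleCount k σ

/-- The normalization constant `h_n(Θ)`. -/
def normConst (θ : ℕ → ℝ) (n : ℕ) : ℝ :=
  (1 / (n.factorial : ℝ)) * ∑ σ : Equiv.Perm (Fin n), weight θ n σ

/-- The probability of `σ` under `ℙ_Θ` (meaningful when `h_n ≠ 0`). -/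
def permProb (θ : ℕ → ℝ) (n : ℕ) (σ : Equiv.Perm (Fin n)) : ℝ :=
  1 / (normConst θ n * (n.factorial : ℝ)) * weight θ n σ

/-- All sets of permutations are measurable. -/
instance permMeasurableSpace (n : ℕ) : MeasurableSpace (Equiv.Perm (Fin n)) := ⊤

/-- The weighted measure `ℙ_Θ` on the symmetric group; it is a probability measure exactly
when `h_n ≠ 0` (for nonnegative `θ`). -/
def permMeasure (θ : ℕ → ℝ) (n : ℕ) : Measure (Equiv.Perm (Fin n)) :=
  ∑ σ : Equiv.Perm (Fin n), ENNReal.ofReal (permProb θ n σ) • Measure.dirac σ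

/-- `v > 0` solves `∑_{k ≥ 1} θ_k e^{-k v} = n` (with convergence of the series). -/
def IsSaddlePoint (θ : ℕ → ℝ) (n : ℕ) (v : ℝ) : Prop :=
  0 < v ∧ HasSum (fun k : ℕ => θ (k + 1) * Real.exp (-((k + 1 : ℕ) : ℝ) * v)) (n : ℝ)

/-- `ℓ = α log n* + (α - 1) log (α log n*)`, as a function of `n*`. -/
def ell (α nStar : ℝ) : ℝ :=
  α * Real.log nStar + (α - 1) * Real.log (α * Real.log nStar)

/-- The vector `(1 / n*) (L_1 - n* ℓ_n, …, L_K - n* ℓ_n)`, as a function of `α`, `n*` and `σ`. -/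
def rescaledLongest {n : ℕ} (K : ℕ) (α nStar : ℝ) (σ : Equiv.Perm (Fin n)) : Fin K → ℝ :=
  fun i => (1 / nStar) * ((longestCycle (i + 1) σ : ℝ) - nStar * ell α nStar)

end

end LongCycles

/-!
Give a permutation `σ` of `n` points the weight `∏ θ_k ^ C_k(σ)`.  Grouping permutations by cycle
type turns sums of weights into sums over partitions of `n`, a partition with `c_k` parts equal
to `k` contributing `∏ (θ_k / k) ^ c_k / c_k!`.  Multiplying the weight by `e^{-n v}` changes
nothing under the normalized measure, so `θ_k / k` may be replaced by
`a_k = θ_k e^{-k v} / k` (`cycleRate`).  After normalization by `exp (-∑ a_k)`, the partition sum is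
the probability that `∑ k Z_k = n`, with `Z_k` independent Poisson variables of parameters `a_k`.
Choosing `v = v_n` makes `n` the mean of this sum.

* **Saddle point.**  The series `∑ k ^ p θ_k e^{-k v}` is asymptotic to
  `Γ(α + p + 1) v ^ (-(α + p + 1))` as `v → 0` (`tendsto_expSeries`, a Riemann sum).  This gives the
  existence and the size of `v_n`, and shows that the mean, variance and third central moment of
  `∑ k Z_k` have orders `v ^ (-(1 + α))`, `v ^ (-(2 + α))` and `v ^ (-(3 + α))`.
* **Local limit theorem.**  Fourier inversion (`integral_exp_sum`) and dominated convergence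
  (`tendsto_partsSum`) give `P(∑ k Z_k = N) ~ c v ^ (1 + α / 2)` whenever `N` is within
  `o(v ^ (-(1 + α / 2)))` of the mean.  The constant does not change when cycles of length at least
  `b` are discarded, as soon as `v b ≥ (3 / 4) α log (1 / v)` (`tendsto_partsSum_cycleRate`).
* **Local law of the longest cycles.**  Let `m_1 > ⋯ > m_K` be integers with
  `v m_i - ℓ_n → y_i`.  Permutations whose `K` longest cycles have lengths `m_1, …, m_K` include
  those made of these cycles and of cycles shorter than `m_K`.  The probability of the latter is
  `∏ a_{m_i}` times `exp (-∑_{k ≥ m_K} a_k)` times a ratio of two local probabilities, which tends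
  to `1` (`le_permMeasure_longestCycle`, `eventually_le_permMeasure`).  The level `ℓ_n` is such that
  `a_m ≈ v e^{-y}` when `v m - ℓ_n ≈ y`, so the sum tends to `e^{-y_K}`.
* **Passage to the limit.**  In the variables `g_i = e^{-y_i}` the lattice of possible lengths cuts
  `(0, ∞)` into cells, and `∏ a_{m_i}` is asymptotically the volume of a cell
  (`tendsto_cycleRate_div_cellWidth`).  So the law of the `g_i` has a density on `(0, ∞)^K`, whose
  lower limit is at least `e^{-g_K}` on the chamber `0 < g_1 < ⋯ < g_K`.  That is the joint
  density of the partial sums `E_1, E_1 + E_2, …` of independent exponential variables, since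
  `partialSums` preserves Lebesgue measure.  Fatou's lemma turns the pointwise lower bound into
  `P(G) ≤ liminf P_n(G)` for every open `G` (`pi_expMeasure_le_liminf`), which is convergence in
  distribution.  As the limit has total mass one, lower bounds suffice: no upper bound and no
  tightness argument is needed.
-/

namespace LongCycles

/-! ### Sums over permutations as sums over partitions, and Fourier inversion -/

/-- The contribution `∏ a_k ^ c_k / c_k!` of a multiset of parts, where `c_k` is the multiplicity
of the part `k`. -/
noncomputable def partsTerm (a : ℕ → ℝ) (m : Multiset ℕ) : ℝ :=
  (m.map a).prod / ∏ k ∈ m.toFinset, ((m.count k).factorial : ℝ)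

open Classical in
/-- The sum of `partsTerm a` over the partitions of `n` with all parts in `s`.  It is the
coefficient of `x ^ n` in `exp (∑ k ∈ s, a k * x ^ k)`; multiplied by `exp (-∑ k ∈ s, a k)` it is
the probability that `∑ k ∈ s, k * Z_k = n`, for independent Poisson variables `Z_k` of
parameters `a k`. -/
noncomputable def partsSum (s : Finset ℕ) (a : ℕ → ℝ) (n : ℕ) : ℝ :=
  ∑ p : n.Partition with ∀ k ∈ p.parts, k ∈ s, partsTerm a p.parts

/-- The partition of `n` into the cycle lengths of `σ`, fixed points included.  It has the parts of
`Equiv.Perm.partition`, which is a partition of `Fintype.card (Fin n)` rather than of `n`. -/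
def permPartition {n : ℕ} (σ : Equiv.Perm (Fin n)) : n.Partition where
  parts := σ.partition.parts
  parts_pos := σ.partition.parts_pos
  parts_sum := by rw [σ.partition.parts_sum, Fintype.card_fin]

/-- The number of permutations with a given cycle type, in the form convenient when fixed points
count as parts `1`; Mathlib states it for the parts that are at least `2`. -/
lemma card_permPartition_eq {n : ℕ} (p : n.Partition) :
    (Finset.univ.filter fun σ : Equiv.Perm (Fin n) => permPartition σ = p).card *
      (p.parts.prod * ∏ k ∈ p.parts.toFinset, (p.parts.count k).factorial) = n.factorial := by
  classical
  set m := p.parts.filter (2 ≤ ·) with hm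
  -- The parts that are at least `2` form the `cycleType`; the other parts are fixed points.
  have hsplit : p.parts = m + Multiset.replicate (p.parts.count 1) 1 := by
    have h1 := Multiset.filter_add_not (2 ≤ ·) p.parts
    rw [← h1, ← hm]
    congr 1
    rw [Multiset.count_add, Multiset.count_filter_of_neg (by norm_num), zero_add,
      Multiset.count_filter_of_pos (by norm_num), ← Multiset.filter_eq']
    refine Multiset.filter_congr fun x hx => ?_
    have := p.parts_pos hx
    lia
  have hsum : m.sum + p.parts.count 1 = n := by
    have := p.parts_sum
    rw [hsplit] at this
    simpa [hm] using this
  have hprod : p.parts.prod = m.prod := by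
    conv_lhs => rw [hsplit]
    simp
  have hcard : (Finset.univ.filter fun σ : Equiv.Perm (Fin n) => permPartition σ = p)
      = Finset.univ.filter fun σ : Equiv.Perm (Fin n) => σ.cycleType = m := by
    ext σ
    simp only [Finset.mem_filter, Finset.mem_univ, true_and]
    constructor
    · rintro rfl
      rw [hm, ← Equiv.Perm.filter_parts_partition_eq_cycleType]
      rfl
    · intro h
      apply Nat.Partition.ext
      change σ.cycleType + Multiset.replicate (Fintype.card (Fin n) - σ.support.card) 1 = _
      rw [hsplit, h]
      congr 2
      have := Equiv.Perm.sum_cycleType σ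
      rw [h] at this
      rw [← this, Fintype.card_fin]
      lia
  have hfact : ∏ k ∈ p.parts.toFinset, (p.parts.count k).factorial
      = (n - m.sum).factorial * ∏ k ∈ m.toFinset, (m.count k).factorial := by
    have hn : n - m.sum = p.parts.count 1 := by lia
    rw [hn]
    have h1 : ∏ k ∈ p.parts.toFinset, (p.parts.count k).factorial
        = ∏ k ∈ insert 1 m.toFinset, (p.parts.count k).factorial := by
      apply Finset.prod_subset
      · intro k hk
        rw [Multiset.mem_toFinset, hsplit, Multiset.mem_add] at hk
        rcases hk with hk | hk
        · simp [hk]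
        · simp [Multiset.eq_of_mem_replicate hk]
      · intro k _ hk
        rw [Multiset.mem_toFinset] at hk
        simp [Multiset.count_eq_zero_of_notMem hk]
    rw [h1, Finset.prod_insert (by simp [hm])]
    congr 1
    refine Finset.prod_congr rfl fun k hk => ?_
    rw [Multiset.mem_toFinset, hm, Multiset.mem_filter] at hk
    rw [hm, Multiset.count_filter_of_pos hk.2]
  have key := Equiv.Perm.card_of_cycleType_mul_eq (Fin n) m
  rw [hcard, hprod, hfact]
  rw [if_pos ⟨by rw [Fintype.card_fin]; lia, fun a ha => (Multiset.mem_filter.1 ha).2⟩] at key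
  rw [Fintype.card_fin] at key
  rw [← key]
  convert! rfl using 2
  ring

lemma weight_eq_map_prod (θ : ℕ → ℝ) {n : ℕ} (σ : Equiv.Perm (Fin n)) :
    weight θ n σ = ((permPartition σ).parts.map θ).prod := by
  classical
  rw [Finset.prod_multiset_map_count]
  symm
  apply Finset.prod_subset
  · intro k hk
    rw [Multiset.mem_toFinset] at hk
    exact Finset.mem_Icc.2 ⟨(permPartition σ).parts_pos hk, Nat.Partition.le_of_mem_parts hk⟩
  · intro k _ hk
    rw [Multiset.mem_toFinset] at hk
    simp [Multiset.count_eq_zero_of_notMem hk]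

lemma partsTerm_div (θ : ℕ → ℝ) (m : Multiset ℕ) :
    partsTerm (fun k => θ k / k) m =
      (m.map θ).prod / ((m.prod * ∏ k ∈ m.toFinset, (m.count k).factorial : ℕ) : ℝ) := by
  rw [partsTerm, Multiset.prod_map_div, div_div]
  push_cast
  simp

/-- Grouping permutations by cycle type. -/
lemma sum_perm_weight (θ : ℕ → ℝ) (n : ℕ) (G : Multiset ℕ → ℝ) :
    ∑ σ : Equiv.Perm (Fin n), G (permPartition σ).parts * weight θ n σ =
      n.factorial * ∑ p : n.Partition, G p.parts * partsTerm (fun k => θ k / k) p.parts := by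
  classical
  rw [← Finset.sum_fiberwise (s := Finset.univ)
    (g := fun σ : Equiv.Perm (Fin n) => permPartition σ),
    Finset.mul_sum]
  refine Finset.sum_congr rfl fun p _ => ?_
  have h : ∀ σ ∈ Finset.univ.filter (fun σ : Equiv.Perm (Fin n) => permPartition σ = p),
      G (permPartition σ).parts * weight θ n σ = G p.parts * (p.parts.map θ).prod := by
    intro σ hσ
    rw [weight_eq_map_prod, (Finset.mem_filter.1 hσ).2]
  rw [Finset.sum_congr rfl h, Finset.sum_const, nsmul_eq_mul, partsTerm_div]
  have hc := card_permPartition_eq p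
  have hpos : 0 < p.parts.prod * ∏ k ∈ p.parts.toFinset, (p.parts.count k).factorial := by
    refine Nat.pos_of_ne_zero fun h0 => ?_
    rw [h0, mul_zero] at hc
    exact n.factorial_ne_zero hc.symm
  have hpos' :
      ((p.parts.prod * ∏ k ∈ p.parts.toFinset, (p.parts.count k).factorial : ℕ) : ℝ) ≠ 0 :=
    Nat.cast_ne_zero.2 hpos.ne'
  rw [← hc, Nat.cast_mul]
  field_simp

lemma integral_exp_int (d : ℤ) :
    ∫ t in (-Real.pi)..Real.pi, Complex.exp ((d : ℂ) * t * Complex.I) =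
      if d = 0 then 2 * Real.pi else 0 := by
  split_ifs with h
  · subst h; simp; ring
  · have h' : (d : ℂ) * Complex.I ≠ 0 := mul_ne_zero (by exact_mod_cast h) Complex.I_ne_zero
    have := integral_exp_mul_complex (a := -Real.pi) (b := Real.pi) h'
    rw [intervalIntegral.integral_congr (g := fun t : ℝ => Complex.exp ((d : ℂ) * Complex.I * t))
      (fun t _ => by ring_nf), this]
    rw [Complex.ofReal_zero, div_eq_zero_iff]; left
    rw [sub_eq_zero, Complex.exp_eq_exp_iff_exists_int]
    refine ⟨d, ?_⟩
    push_cast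
    ring

/-- The multinomial theorem, indexed by multisets of size `j`. -/
lemma pow_sum_exp (s : Finset ℕ) (a : ℕ → ℝ) (j : ℕ) (t : ℝ) :
    (∑ k ∈ s, (a k : ℂ) * Complex.exp (k * t * Complex.I)) ^ j / j.factorial =
      ∑ x ∈ s.sym j, (partsTerm a x.1 : ℂ) * Complex.exp ((x.1.sum : ℂ) * t * Complex.I) := by
  classical
  rw [Finset.sum_pow, Finset.sum_div]
  refine Finset.sum_congr rfl fun x _ => ?_
  have h1 : (x.1.map fun k : ℕ => (a k : ℂ) * Complex.exp (k * t * Complex.I)).prod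
      = ((x.1.map a).prod : ℝ) * Complex.exp ((x.1.sum : ℂ) * t * Complex.I) := by
    generalize x.1 = m
    induction m using Multiset.induction with
    | empty => simp
    | cons b m ih =>
      simp only [Multiset.map_cons, Multiset.prod_cons, ih, Multiset.sum_cons, Complex.ofReal_mul]
      push_cast
      rw [add_mul, add_mul, Complex.exp_add]
      ring
  have h2 : (x.1.countPerms : ℂ) * ((∏ k ∈ x.1.toFinset, (x.1.count k).factorial : ℕ) : ℂ) =
      j.factorial := by
    have hc := Nat.multinomial_spec x.1.toFinsupp.support x.1.toFinsupp
    have hx : ∑ i ∈ x.1.toFinsupp.support, x.1.toFinsupp i = j := by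
      simp only [Multiset.toFinsupp_support, Multiset.toFinsupp_apply]
      rw [Multiset.toFinset_sum_count_eq]
      exact x.2
    rw [hx] at hc
    rw [← hc, Multiset.countPerms, mul_comm, Nat.cast_mul]
    simp only [Multiset.toFinsupp_support, Multiset.toFinsupp_apply, Finsupp.multinomial_eq]
  rw [h1, partsTerm]
  have h3 : ((∏ k ∈ x.1.toFinset, (x.1.count k).factorial : ℕ) : ℂ) ≠ 0 := by
    exact_mod_cast Finset.prod_ne_zero_iff.2 fun k _ => Nat.factorial_ne_zero _
  have h4 : (j.factorial : ℂ) ≠ 0 := by exact_mod_cast Nat.factorial_ne_zero _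
  rw [← h2] at h4 ⊢
  push_cast at h3 h4 ⊢
  have h5 := left_ne_zero_of_mul h4
  field_simp

lemma sum_sym_eq_partsSum (s : Finset ℕ) (hs : ∀ k ∈ s, 0 < k) (a : ℕ → ℝ) (n : ℕ) {J : ℕ}
    (hJ : n < J) :
    ∑ j ∈ Finset.range J, ∑ x ∈ s.sym j with x.1.sum = n, partsTerm a x.1 = partsSum s a n := by
  classical
  rw [Finset.sum_sigma', partsSum]
  symm
  -- A partition of `n` has at most `n < J` parts, so it occurs for exactly one size `j`.
  refine Finset.sum_bij (i := fun p _ => ⟨Multiset.card p.parts, ⟨p.parts, rfl⟩⟩) ?_ ?_ ?_ ?_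
  · intro p hp
    simp only [Finset.mem_filter, Finset.mem_univ, true_and] at hp
    refine Finset.mem_sigma.2 ⟨Finset.mem_range.2 (lt_of_le_of_lt ?_ hJ),
      Finset.mem_filter.2 ⟨Finset.mem_sym_iff.2 fun k hk => hp k hk, p.parts_sum⟩⟩
    conv_rhs => rw [← p.parts_sum]
    have := Multiset.card_nsmul_le_sum (s := p.parts) (a := 1) (fun x hx => p.parts_pos hx)
    simpa using this
  · intro p _ q _ h
    apply Nat.Partition.ext
    have := congrArg (fun y : (Σ j, Sym ℕ j) => (y.2.1 : Multiset ℕ)) h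
    exact this
  · rintro ⟨j, x⟩ hx
    simp only [Finset.mem_sigma, Finset.mem_range, Finset.mem_filter, Finset.mem_sym_iff] at hx
    refine ⟨⟨x.1, fun {k} hk => hs k (hx.2.1 k hk), hx.2.2⟩, ?_, ?_⟩
    · simp only [Finset.mem_filter, Finset.mem_univ, true_and]
      exact fun k hk => hx.2.1 k hk
    · obtain ⟨x, rfl⟩ := x
      rfl
  · intro p _
    rfl

/-- Fourier inversion: `partsSum s a n` is the `n`-th Fourier coefficient of
`exp (∑ k ∈ s, a k * exp (i k t))`. -/
lemma integral_exp_sum (s : Finset ℕ) (hs : ∀ k ∈ s, 0 < k) (a : ℕ → ℝ) (n : ℕ) :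
    ∫ t in (-Real.pi)..Real.pi, Complex.exp (∑ k ∈ s, (a k : ℂ) * Complex.exp (k * t * Complex.I)) *
      Complex.exp (-(n * t * Complex.I)) = 2 * Real.pi * partsSum s a n := by
  classical
  set g : ℝ → ℂ := fun t => ∑ k ∈ s, (a k : ℂ) * Complex.exp (k * t * Complex.I) with hg
  set A : ℝ := ∑ k ∈ s, |a k|
  have hbound : ∀ t, ‖g t‖ ≤ A := by
    intro t
    refine (norm_sum_le _ _).trans (Finset.sum_le_sum fun k _ => ?_)
    rw [norm_mul, show (k : ℂ) * t * Complex.I = ((k * t : ℝ) : ℂ) * Complex.I by push_cast; ring,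
      Complex.norm_exp_ofReal_mul_I, mul_one, Complex.norm_real, Real.norm_eq_abs]
  have hgc : Continuous g := by fun_prop
  -- Expand the exponential in powers of `g` and integrate term by term.
  have h1 : HasSum (fun j : ℕ => ∫ t in (-Real.pi)..Real.pi, g t ^ j / j.factorial *
      Complex.exp (-(n * t * Complex.I)))
      (∫ t in (-Real.pi)..Real.pi, Complex.exp (g t) * Complex.exp (-(n * t * Complex.I))) := by
    refine intervalIntegral.hasSum_integral_of_dominated_convergence
      (bound := fun j _ => A ^ j / j.factorial) ?_ ?_ ?_ ?_ ?_
    · intro j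
      exact (by fun_prop : Continuous _).aestronglyMeasurable
    · intro j
      refine Eventually.of_forall fun t _ => ?_
      rw [norm_mul, norm_div, norm_pow,
        show -((n : ℂ) * t * Complex.I) = ((-(n * t) : ℝ) : ℂ) * Complex.I by push_cast; ring,
        Complex.norm_exp_ofReal_mul_I, mul_one, Complex.norm_natCast]
      gcongr
      exact hbound t
    · exact Eventually.of_forall fun t _ => Real.summable_pow_div_factorial A
    · exact intervalIntegrable_const
    · refine Eventually.of_forall fun t _ => ?_
      rw [Complex.exp_eq_exp_ℂ]
      exact (NormedSpace.expSeries_div_hasSum_exp (g t)).mul_right _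
  have h2 : ∀ j : ℕ, ∫ t in (-Real.pi)..Real.pi, g t ^ j / j.factorial *
      Complex.exp (-(n * t * Complex.I)) =
      ((2 * Real.pi * ∑ x ∈ s.sym j with x.1.sum = n, partsTerm a x.1 : ℝ) : ℂ) := by
    intro j
    have : ∀ t : ℝ, g t ^ j / j.factorial * Complex.exp (-(n * t * Complex.I)) =
        ∑ x ∈ s.sym j, (partsTerm a x.1 : ℂ) * Complex.exp
          ((((x.1.sum : ℤ) - n : ℤ) : ℂ) * t * Complex.I) := by
      intro t
      rw [hg, pow_sum_exp, Finset.sum_mul]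
      refine Finset.sum_congr rfl fun x _ => ?_
      rw [mul_assoc, ← Complex.exp_add]
      congr 2
      rw [Int.cast_sub, Int.cast_natCast, Int.cast_natCast]
      ring
    rw [intervalIntegral.integral_congr (fun t _ => this t), intervalIntegral.integral_finsetSum]
    · rw [Finset.sum_filter, Finset.mul_sum, Complex.ofReal_sum]
      refine Finset.sum_congr rfl fun x _ => ?_
      rw [intervalIntegral.integral_const_mul, integral_exp_int]
      have : ((x.1.sum : ℤ) - n : ℤ) = 0 ↔ x.1.sum = n := by lia
      simp only [this]
      split_ifs
      · push_cast; ring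
      · simp
    · intro x _
      exact (by fun_prop : Continuous _).intervalIntegrable _ _
  simp_rw [h2] at h1
  -- Only sizes `j ≤ n` contribute, since all parts are positive.
  have h3 : HasSum (fun j : ℕ =>
      ((2 * Real.pi * ∑ x ∈ s.sym j with x.1.sum = n, partsTerm a x.1 : ℝ) : ℂ))
      (∑ j ∈ Finset.range (n + 1),
        ((2 * Real.pi * ∑ x ∈ s.sym j with x.1.sum = n, partsTerm a x.1 : ℝ) : ℂ)) := by
    refine hasSum_sum_of_ne_finset_zero fun j hj => ?_
    rw [Finset.filter_false_of_mem]
    · simp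
    · intro x hx hxn
      rw [Finset.mem_sym_iff] at hx
      have := Multiset.card_nsmul_le_sum (s := x.1) (a := 1) (fun k hk => hs k (hx k hk))
      rw [hxn, x.2] at this
      simp at hj this
      lia
  rw [h1.unique h3, ← Complex.ofReal_sum, ← Finset.mul_sum, sum_sym_eq_partsSum s hs a n
    (Nat.lt_succ_self n)]
  push_cast
  ring

/-! ### The exponential series and the saddle point -/

/-- The step function equal to `v ^ β * θ k * exp (-k v)` on `((k - 1) v, k v]`.  Its integral over
`(0, ∞)` is `v ^ (β + 1)` times the exponential series of `θ` at `v`. -/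
noncomputable def stepFun (θ : ℕ → ℝ) (β v y : ℝ) : ℝ :=
  v ^ β * (θ ⌈y / v⌉₊ * Real.exp (-(⌈y / v⌉₊ : ℝ) * v))

lemma exists_bound_of_isEquivalent {θ : ℕ → ℝ} {β : ℝ} (hθ : θ ~[atTop] fun k : ℕ => (k : ℝ) ^ β) :
    ∃ C : ℝ, 0 < C ∧ ∀ k : ℕ, 1 ≤ k → |θ k| ≤ C * (k : ℝ) ^ β := by
  obtain ⟨C, hC, h⟩ := Asymptotics.bound_of_isBigO_nat_atTop hθ.isBigO
  refine ⟨C, hC, fun k hk => ?_⟩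
  have hk' : (0 : ℝ) < k := by exact_mod_cast hk
  have := h (x := k) (Real.rpow_pos_of_pos hk' β).ne'
  rwa [Real.norm_eq_abs, Real.norm_of_nonneg (by positivity)] at this

lemma measurable_stepFun (θ : ℕ → ℝ) (β v : ℝ) : Measurable (stepFun θ β v) := by
  have h1 : Measurable fun k : ℕ => v ^ β * (θ k * Real.exp (-(k : ℝ) * v)) := measurable_from_top
  have h2 : Measurable fun y : ℝ => ⌈y / v⌉₊ := Nat.measurable_ceil.comp (measurable_id.div_const v)
  exact h1.comp h2

lemma add_rpow_le {β x y : ℝ} (hβ : 0 ≤ β) (hx : 0 ≤ x) (hy : 0 ≤ y) :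
    (x + y) ^ β ≤ 2 ^ β * (x ^ β + y ^ β) := by
  have hxb : 0 ≤ x ^ β := Real.rpow_nonneg hx β
  have hyb : 0 ≤ y ^ β := Real.rpow_nonneg hy β
  rcases le_total x y with h | h
  · calc (x + y) ^ β ≤ (2 * y) ^ β := Real.rpow_le_rpow (by positivity) (by linarith) hβ
      _ = 2 ^ β * y ^ β := Real.mul_rpow (by norm_num) hy
      _ ≤ _ := by gcongr; linarith
  · calc (x + y) ^ β ≤ (2 * x) ^ β := Real.rpow_le_rpow (by positivity) (by linarith) hβ
      _ = 2 ^ β * x ^ β := Real.mul_rpow (by norm_num) hx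
      _ ≤ _ := by gcongr; linarith

/-- The dominating function for all `v ≤ V`, which rests on `y ≤ ⌈y / v⌉ v ≤ y + v`. -/
lemma abs_stepFun_le {θ : ℕ → ℝ} {β C V v y : ℝ} (hβ : 0 ≤ β) (hC : 0 < C)
    (hθ : ∀ k : ℕ, 1 ≤ k → |θ k| ≤ C * (k : ℝ) ^ β) (hv : 0 < v) (hvV : v ≤ V) (hy : 0 < y) :
    |stepFun θ β v y| ≤ C * 2 ^ β * (y ^ β + V ^ β) * Real.exp (-y) := by
  have hpos : 0 < y / v := div_pos hy hv
  have h1 : 1 ≤ ⌈y / v⌉₊ := Nat.one_le_ceil_iff.2 hpos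
  have hle : y ≤ (⌈y / v⌉₊ : ℝ) * v := (div_le_iff₀ hv).1 (Nat.le_ceil _)
  have hlt : v * (⌈y / v⌉₊ : ℝ) ≤ y + v := by
    have := Nat.ceil_lt_add_one hpos.le
    have h2 : (⌈y / v⌉₊ : ℝ) * v < (y / v + 1) * v := by gcongr
    rw [add_mul, div_mul_cancel₀ _ hv.ne'] at h2
    linarith
  have hk0 : (0 : ℝ) ≤ (⌈y / v⌉₊ : ℝ) := Nat.cast_nonneg _
  rw [stepFun, abs_mul, abs_mul, abs_of_pos (Real.exp_pos _),
    abs_of_pos (Real.rpow_pos_of_pos hv β)]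
  calc v ^ β * (|θ ⌈y / v⌉₊| * Real.exp (-(⌈y / v⌉₊ : ℝ) * v))
      ≤ v ^ β * ((C * (⌈y / v⌉₊ : ℝ) ^ β) * Real.exp (-y)) := by
        gcongr
        · exact hθ _ h1
        · linarith
    _ = C * (v * (⌈y / v⌉₊ : ℝ)) ^ β * Real.exp (-y) := by
        rw [Real.mul_rpow hv.le hk0]; ring
    _ ≤ C * (y + V) ^ β * Real.exp (-y) := by
        gcongr
        linarith
    _ ≤ _ := by
        rw [mul_assoc C (2 ^ β)]
        refine mul_le_mul_of_nonneg_right (mul_le_mul_of_nonneg_left ?_ hC.le) (Real.exp_pos _).le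
        exact add_rpow_le hβ hy.le (hv.le.trans hvV)

lemma integrableOn_rpow_add_mul_exp {β : ℝ} (hβ : 0 ≤ β) (C V : ℝ) :
    IntegrableOn (fun y => C * (y ^ β + V) * Real.exp (-y)) (Set.Ioi 0) := by
  have h1 := Real.GammaIntegral_convergent (s := β + 1) (by linarith)
  have h2 := Real.GammaIntegral_convergent (s := 1) (by norm_num)
  have := Integrable.add (h1.const_mul C) (h2.const_mul (C * V))
  refine IntegrableOn.congr_fun this (fun y _ => ?_) measurableSet_Ioi
  simp
  ring

lemma integrableOn_stepFun {θ : ℕ → ℝ} {β v : ℝ} (hβ : 0 ≤ β)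
    (hθ : θ ~[atTop] fun k : ℕ => (k : ℝ) ^ β) (hv : 0 < v) :
    IntegrableOn (stepFun θ β v) (Set.Ioi 0) := by
  obtain ⟨C, hC, hb⟩ := exists_bound_of_isEquivalent hθ
  refine (integrableOn_rpow_add_mul_exp hβ (C * 2 ^ β) (v ^ β)).mono'
    (measurable_stepFun θ β v).aestronglyMeasurable ?_
  filter_upwards [ae_restrict_mem measurableSet_Ioi] with y hy
  exact abs_stepFun_le hβ hC hb hv le_rfl hy

lemma hasSum_stepFun {θ : ℕ → ℝ} {β v : ℝ} (hβ : 0 ≤ β)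
    (hθ : θ ~[atTop] fun k : ℕ => (k : ℝ) ^ β) (hv : 0 < v) :
    HasSum (fun k : ℕ => v ^ (β + 1) * (θ (k + 1) * Real.exp (-((k + 1 : ℕ) : ℝ) * v)))
      (∫ y in Set.Ioi 0, stepFun θ β v y) := by
  have hmono : Monotone fun k : ℕ => (k : ℝ) * v := fun i j h => by
    have : (i : ℝ) ≤ j := by exact_mod_cast h
    exact mul_le_mul_of_nonneg_right this hv.le
  -- The intervals on which the step function is constant cover `(0, ∞)`.
  have hU : (⋃ k : ℕ, Set.Ioc ((k : ℝ) * v) (((k + 1 : ℕ) : ℝ) * v)) = Set.Ioi 0 := by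
    ext y
    simp only [Set.mem_iUnion, Set.mem_Ioc, Set.mem_Ioi]
    constructor
    · rintro ⟨k, hk, _⟩
      exact lt_of_le_of_lt (by positivity) hk
    · intro hy
      have hpos : 0 < y / v := div_pos hy hv
      obtain ⟨k, hk⟩ := Nat.exists_eq_succ_of_ne_zero (Nat.ceil_pos.2 hpos).ne'
      refine ⟨k, ?_, ?_⟩
      · have : k < ⌈y / v⌉₊ := by lia
        exact (lt_div_iff₀ hv).1 (Nat.lt_ceil.1 this)
      · rw [← div_le_iff₀ hv]
        exact Nat.ceil_le.1 hk.le
  have key := hasSum_integral_iUnion (μ := volume) (f := stepFun θ β v)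
    (s := fun k : ℕ => Set.Ioc ((k : ℝ) * v) (((k + 1 : ℕ) : ℝ) * v))
    (fun k => measurableSet_Ioc) hmono.pairwise_disjoint_on_Ioc_succ
    (by rw [hU]; exact integrableOn_stepFun hβ hθ hv)
  rw [hU] at key
  suffices h : (fun k : ℕ => v ^ (β + 1) * (θ (k + 1) * Real.exp (-((k + 1 : ℕ) : ℝ) * v))) =
      fun k : ℕ => ∫ y in Set.Ioc ((k : ℝ) * v) (((k + 1 : ℕ) : ℝ) * v), stepFun θ β v y by
    rw [h]; exact key
  funext k
  have hc : Set.EqOn (stepFun θ β v)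
      (fun _ => v ^ β * (θ (k + 1) * Real.exp (-((k + 1 : ℕ) : ℝ) * v)))
      (Set.Ioc ((k : ℝ) * v) (((k + 1 : ℕ) : ℝ) * v)) := by
    intro y hy
    have : ⌈y / v⌉₊ = k + 1 := by
      rw [Nat.ceil_eq_iff (by lia)]
      exact ⟨by rw [lt_div_iff₀ hv]; simpa using hy.1, by rw [div_le_iff₀ hv]; exact hy.2⟩
    rw [stepFun, this]
  rw [setIntegral_congr_fun measurableSet_Ioc hc, setIntegral_const, Real.volume_real_Ioc_of_le
    (hmono (Nat.le_succ k)), Real.rpow_add_one hv.ne']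
  push_cast
  rw [smul_eq_mul]
  ring

lemma summable_mul_exp {θ : ℕ → ℝ} {β v : ℝ} (hβ : 0 ≤ β)
    (hθ : θ ~[atTop] fun k : ℕ => (k : ℝ) ^ β) (hv : 0 < v) :
    Summable fun k : ℕ => θ (k + 1) * Real.exp (-((k + 1 : ℕ) : ℝ) * v) :=
  (summable_mul_left_iff (Real.rpow_pos_of_pos hv (β + 1)).ne').1 (hasSum_stepFun hβ hθ hv).summable

/-- The series `∑_{k ≥ 1} θ_k e^{-k v}`. -/
noncomputable def expSeries (θ : ℕ → ℝ) (v : ℝ) : ℝ :=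
  ∑' k : ℕ, θ (k + 1) * Real.exp (-((k + 1 : ℕ) : ℝ) * v)

lemma tendsto_stepFun {θ : ℕ → ℝ} {β y : ℝ}
    (hθ : θ ~[atTop] fun k : ℕ => (k : ℝ) ^ β) (hy : 0 < y) :
    Tendsto (fun v => stepFun θ β v y) (𝓝[>] 0) (𝓝 (Real.exp (-y) * y ^ (β + 1 - 1))) := by
  have hdiv : Tendsto (fun v : ℝ => y / v) (𝓝[>] 0) atTop :=
    tendsto_inv_nhdsGT_zero.const_mul_atTop hy |>.congr fun v => (div_eq_mul_inv _ _).symm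
  have hceil : Tendsto (fun v : ℝ => ⌈y / v⌉₊) (𝓝[>] 0) atTop := tendsto_nat_ceil_atTop.comp hdiv
  have hkv : Tendsto (fun v : ℝ => (⌈y / v⌉₊ : ℝ) * v) (𝓝[>] 0) (𝓝 y) := by
    have h1 : Tendsto (fun v : ℝ => (⌈y / v⌉₊ : ℝ) / (y / v) * y) (𝓝[>] 0) (𝓝 (1 * y)) :=
      ((tendsto_nat_ceil_div_atTop (R := ℝ)).comp hdiv).mul_const y
    rw [one_mul] at h1
    refine h1.congr' ?_
    filter_upwards [self_mem_nhdsWithin] with v (hv : 0 < v)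
    field_simp
  have hratio : Tendsto (fun k : ℕ => θ k / (k : ℝ) ^ β) atTop (𝓝 1) := by
    refine (Asymptotics.isEquivalent_iff_tendsto_one ?_).1 hθ
    filter_upwards [eventually_ge_atTop 1] with k hk
    have : (0 : ℝ) < k := by exact_mod_cast hk
    exact (Real.rpow_pos_of_pos this β).ne'
  have h1 : Tendsto (fun v : ℝ => θ ⌈y / v⌉₊ / (⌈y / v⌉₊ : ℝ) ^ β * ((⌈y / v⌉₊ : ℝ) * v) ^ β *
      Real.exp (-((⌈y / v⌉₊ : ℝ) * v))) (𝓝[>] 0) (𝓝 (1 * y ^ β * Real.exp (-y))) :=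
    ((hratio.comp hceil).mul (hkv.rpow_const (Or.inl hy.ne'))).mul
      (Real.continuous_exp.tendsto _ |>.comp hkv.neg)
  rw [show Real.exp (-y) * y ^ (β + 1 - 1) = 1 * y ^ β * Real.exp (-y) by
    rw [add_sub_cancel_right]; ring]
  refine h1.congr' ?_
  filter_upwards [self_mem_nhdsWithin] with v (hv : 0 < v)
  have hk : (0 : ℝ) < (⌈y / v⌉₊ : ℝ) := by exact_mod_cast Nat.one_le_ceil_iff.2 (div_pos hy hv)
  rw [stepFun, Real.mul_rpow hk.le hv.le, neg_mul]
  have := (Real.rpow_pos_of_pos hk β).ne'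
  field_simp

/-- The Abelian theorem for the exponential series: if `θ_k ~ k ^ β`, then
`∑ θ_k e^{-k v} ~ Γ(β + 1) v ^ (-(β + 1))` as `v → 0`. -/
lemma tendsto_expSeries {θ : ℕ → ℝ} {β : ℝ} (hβ : 0 ≤ β)
    (hθ : θ ~[atTop] fun k : ℕ => (k : ℝ) ^ β) :
    Tendsto (fun v => v ^ (β + 1) * expSeries θ v) (𝓝[>] 0) (𝓝 (Real.Gamma (β + 1))) := by
  obtain ⟨C, hC, hb⟩ := exists_bound_of_isEquivalent hθ
  have h : Tendsto (fun v => ∫ y in Set.Ioi 0, stepFun θ β v y) (𝓝[>] 0)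
      (𝓝 (∫ y in Set.Ioi 0, Real.exp (-y) * y ^ (β + 1 - 1))) := by
    refine tendsto_integral_filter_of_dominated_convergence
      (fun y => C * 2 ^ β * (y ^ β + 1 ^ β) * Real.exp (-y)) ?_ ?_
      (integrableOn_rpow_add_mul_exp hβ _ _) ?_
    · exact Eventually.of_forall fun v => (measurable_stepFun θ β v).aestronglyMeasurable
    · filter_upwards [self_mem_nhdsWithin, mem_nhdsWithin_of_mem_nhds
        (Iic_mem_nhds zero_lt_one)] with
        v (hv : 0 < v) (hv1 : v ≤ 1)
      filter_upwards [ae_restrict_mem measurableSet_Ioi] with y hy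
      exact abs_stepFun_le hβ hC hb hv hv1 hy
    · filter_upwards [ae_restrict_mem measurableSet_Ioi] with y hy
      exact tendsto_stepFun hθ hy
  rw [← Real.Gamma_eq_integral (by linarith)] at h
  refine h.congr' ?_
  filter_upwards [self_mem_nhdsWithin] with v (hv : 0 < v)
  rw [expSeries, ← tsum_mul_left]
  exact (hasSum_stepFun hβ hθ hv).tsum_eq.symm

lemma isEquivalent_pow_mul {θ : ℕ → ℝ} {β : ℝ} (hθ : θ ~[atTop] fun k : ℕ => (k : ℝ) ^ β) (p : ℕ) :
    (fun k : ℕ => (k : ℝ) ^ p * θ k) ~[atTop] fun k : ℕ => (k : ℝ) ^ (β + p) := by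
  have h := (Asymptotics.IsEquivalent.refl (u := fun k : ℕ => (k : ℝ) ^ p) (l := atTop)).mul hθ
  refine h.congr_right ?_
  filter_upwards [eventually_ge_atTop 1] with k hk
  have hk' : (0 : ℝ) < k := by exact_mod_cast hk
  simp [Real.rpow_add_natCast hk'.ne', mul_comm]

section SaddlePoint

variable {θ : ℕ → ℝ} {β : ℝ}

lemma expSeries_antitoneOn (hβ : 0 ≤ β) (h0 : ∀ k : ℕ, 1 ≤ k → 0 ≤ θ k)
    (hθ : θ ~[atTop] fun k : ℕ => (k : ℝ) ^ β) : AntitoneOn (expSeries θ) (Set.Ioi 0) := by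
  intro u (hu : 0 < u) w (hw : 0 < w) huw
  refine (summable_mul_exp hβ hθ hw).tsum_le_tsum (fun k => ?_) (summable_mul_exp hβ hθ hu)
  refine mul_le_mul_of_nonneg_left (Real.exp_le_exp.2 ?_) (h0 _ (by lia))
  have : (0 : ℝ) ≤ ((k + 1 : ℕ) : ℝ) := Nat.cast_nonneg _
  nlinarith

lemma eventually_half_rpow_le (hθ : θ ~[atTop] fun k : ℕ => (k : ℝ) ^ β) :
    ∀ᶠ k : ℕ in atTop, (1 / 2) * (k : ℝ) ^ β ≤ θ k := by
  have h1 : ∀ᶠ k : ℕ in atTop, (k : ℝ) ^ β ≠ 0 := by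
    filter_upwards [eventually_ge_atTop 1] with k hk
    exact (Real.rpow_pos_of_pos (by exact_mod_cast hk) β).ne'
  have h2 := (Asymptotics.isEquivalent_iff_tendsto_one h1).1 hθ
  filter_upwards [h2.eventually_const_lt (show (1 / 2 : ℝ) < 1 by norm_num), eventually_ge_atTop 1]
    with k hk hk1
  exact ((lt_div_iff₀ (Real.rpow_pos_of_pos (by exact_mod_cast hk1) β)).1 hk).le

lemma expSeries_strictAntiOn (hβ : 0 ≤ β) (h0 : ∀ k : ℕ, 1 ≤ k → 0 ≤ θ k)
    (hθ : θ ~[atTop] fun k : ℕ => (k : ℝ) ^ β) : StrictAntiOn (expSeries θ) (Set.Ioi 0) := by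
  intro u (hu : 0 < u) w (hw : 0 < w) huw
  -- Strictness comes from one index with `θ_j > 0`.
  obtain ⟨j, hj, hj1⟩ := ((eventually_half_rpow_le hθ).and (eventually_ge_atTop 1)).exists
  obtain ⟨i, rfl⟩ := Nat.exists_eq_succ_of_ne_zero (by lia : j ≠ 0)
  have hpos : 0 < θ (i + 1) := by
    have : (0 : ℝ) < ((i + 1 : ℕ) : ℝ) ^ β := Real.rpow_pos_of_pos (by positivity) β
    linarith
  refine (summable_mul_exp hβ hθ hw).tsum_lt_tsum (i := i) (fun k => ?_) ?_
    (summable_mul_exp hβ hθ hu)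
  · refine mul_le_mul_of_nonneg_left (Real.exp_le_exp.2 ?_) (h0 _ (by lia))
    have : (0 : ℝ) ≤ ((k + 1 : ℕ) : ℝ) := Nat.cast_nonneg _
    nlinarith
  · refine mul_lt_mul_of_pos_left (Real.exp_lt_exp.2 ?_) hpos
    have : (0 : ℝ) < ((i + 1 : ℕ) : ℝ) := by positivity
    nlinarith

lemma continuousOn_expSeries (hβ : 0 ≤ β) (h0 : ∀ k : ℕ, 1 ≤ k → 0 ≤ θ k)
    (hθ : θ ~[atTop] fun k : ℕ => (k : ℝ) ^ β) : ContinuousOn (expSeries θ) (Set.Ioi 0) := by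
  intro w (hw : 0 < w)
  have hc : ContinuousOn (expSeries θ) (Set.Ici (w / 2)) := by
    refine continuousOn_tsum (fun k => by fun_prop)
      (summable_mul_exp hβ hθ (half_pos hw)) (fun k x hx => ?_)
    have hx' : w / 2 ≤ x := hx
    rw [Real.norm_of_nonneg (mul_nonneg (h0 _ (by lia)) (Real.exp_pos _).le)]
    refine mul_le_mul_of_nonneg_left (Real.exp_le_exp.2 ?_) (h0 _ (by lia))
    have : (0 : ℝ) ≤ ((k + 1 : ℕ) : ℝ) := Nat.cast_nonneg _
    nlinarith
  exact (hc.continuousAt (Ici_mem_nhds (by linarith))).continuousWithinAt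

lemma tendsto_expSeries_atTop (hβ : 0 ≤ β) (hθ : θ ~[atTop] fun k : ℕ => (k : ℝ) ^ β) :
    Tendsto (expSeries θ) (𝓝[>] 0) atTop := by
  have h1 : Tendsto (fun v : ℝ => v ^ (-(β + 1))) (𝓝[>] 0) atTop :=
    tendsto_rpow_neg_nhdsGT_zero (by linarith)
  refine (h1.atTop_mul_pos (Real.Gamma_pos_of_pos (by linarith))
    (tendsto_expSeries hβ hθ)).congr' ?_
  filter_upwards [self_mem_nhdsWithin] with v (hv : 0 < v)
  rw [← mul_assoc, ← Real.rpow_add hv]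
  simp

lemma expSeries_nonneg (h0 : ∀ k : ℕ, 1 ≤ k → 0 ≤ θ k) (v : ℝ) : 0 ≤ expSeries θ v :=
  tsum_nonneg fun k => mul_nonneg (h0 _ (by lia)) (Real.exp_pos _).le

/-- Exponential decay at infinity,
  which lets the saddle point equation be solved by the intermediate
value theorem. -/
lemma expSeries_le_exp_mul (hβ : 0 ≤ β) (h0 : ∀ k : ℕ, 1 ≤ k → 0 ≤ θ k)
    (hθ : θ ~[atTop] fun k : ℕ => (k : ℝ) ^ β) {v : ℝ} (hv : 1 ≤ v) :
    expSeries θ v ≤ Real.exp (-(v - 1)) * expSeries θ 1 := by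
  rw [expSeries, expSeries, ← tsum_mul_left]
  refine (summable_mul_exp hβ hθ (by linarith)).tsum_le_tsum (fun k => ?_)
    ((summable_mul_exp hβ hθ one_pos).mul_left _)
  rw [mul_left_comm, ← Real.exp_add]
  refine mul_le_mul_of_nonneg_left (Real.exp_le_exp.2 ?_) (h0 _ (by lia))
  have : (0 : ℝ) ≤ (k : ℝ) := Nat.cast_nonneg _
  push_cast
  nlinarith

lemma isSaddlePoint_iff (hβ : 0 ≤ β) (hθ : θ ~[atTop] fun k : ℕ => (k : ℝ) ^ β) (n : ℕ) (v : ℝ) :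
    IsSaddlePoint θ n v ↔ 0 < v ∧ expSeries θ v = n := by
  refine and_congr_right fun hv => ⟨fun h => h.tsum_eq, fun h => ?_⟩
  rw [← h]
  exact (summable_mul_exp hβ hθ hv).hasSum

lemma existsUnique_isSaddlePoint (hβ : 0 ≤ β) (h0 : ∀ k : ℕ, 1 ≤ k → 0 ≤ θ k)
    (hθ : θ ~[atTop] fun k : ℕ => (k : ℝ) ^ β) {n : ℕ} (hn : 1 ≤ n) :
    ∃! v : ℝ, IsSaddlePoint θ n v := by
  simp_rw [isSaddlePoint_iff hβ hθ]
  have hn' : (0 : ℝ) < n := by exact_mod_cast hn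
  obtain ⟨u, hu, hu0⟩ := (((tendsto_expSeries_atTop hβ hθ).eventually_ge_atTop (n : ℝ)).and
    self_mem_nhdsWithin).exists
  replace hu0 : 0 < u := hu0
  have hlim : Tendsto (fun v : ℝ => Real.exp (-(v - 1)) * expSeries θ 1) atTop
      (𝓝 (0 * expSeries θ 1)) := by
    refine Tendsto.mul_const _ (Real.tendsto_exp_neg_atTop_nhds_zero.comp ?_)
    exact tendsto_atTop_add_const_right _ _ tendsto_id
  rw [zero_mul] at hlim
  obtain ⟨w, hw, hw1⟩ := ((hlim.eventually_lt_const hn').and (eventually_ge_atTop (max 1 u))).exists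
  have hw1' : 1 ≤ w := (le_max_left _ _).trans hw1
  have hwu : u ≤ w := (le_max_right _ _).trans hw1
  have hwn : expSeries θ w ≤ n := (expSeries_le_exp_mul hβ h0 hθ hw1').trans hw.le
  have hcont : ContinuousOn (expSeries θ) (Set.Icc u w) :=
    (continuousOn_expSeries hβ h0 hθ).mono fun x hx => lt_of_lt_of_le hu0 hx.1
  obtain ⟨v, hv, hvn⟩ := intermediate_value_Icc' hwu hcont ⟨hwn, hu⟩
  refine ⟨v, ⟨lt_of_lt_of_le hu0 hv.1, hvn⟩, fun y hy => ?_⟩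
  exact (expSeries_strictAntiOn hβ h0 hθ).injOn hy.1 (lt_of_lt_of_le hu0 hv.1) (hy.2.trans hvn.symm)

variable {v : ℕ → ℝ}

lemma tendsto_saddlePoint (hβ : 0 ≤ β) (h0 : ∀ k : ℕ, 1 ≤ k → 0 ≤ θ k)
    (hθ : θ ~[atTop] fun k : ℕ => (k : ℝ) ^ β) (hv : ∀ n : ℕ, 1 ≤ n → IsSaddlePoint θ n (v n)) :
    Tendsto v atTop (𝓝[>] 0) := by
  rw [tendsto_nhdsWithin_iff]
  refine ⟨?_, ?_⟩
  · rw [tendsto_order]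
    refine ⟨fun a ha => ?_, fun a ha => ?_⟩
    · filter_upwards [eventually_ge_atTop 1] with n hn using ha.trans (hv n hn).1
    · filter_upwards [eventually_ge_atTop 1, tendsto_natCast_atTop_atTop.eventually_gt_atTop
        (expSeries θ a)] with n hn hna
      by_contra! h
      have h1 := expSeries_antitoneOn hβ h0 hθ (Set.mem_Ioi.2 ha) (Set.mem_Ioi.2 (hv n hn).1) h
      rw [((isSaddlePoint_iff hβ hθ _ _).1 (hv n hn)).2] at h1
      linarith
  · filter_upwards [eventually_ge_atTop 1] with n hn using (hv n hn).1

lemma inv_saddlePoint_isEquivalent (hβ : 0 ≤ β) (h0 : ∀ k : ℕ, 1 ≤ k → 0 ≤ θ k)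
    (hθ : θ ~[atTop] fun k : ℕ => (k : ℝ) ^ β) (hv : ∀ n : ℕ, 1 ≤ n → IsSaddlePoint θ n (v n)) :
    (fun n : ℕ => (v n)⁻¹) ~[atTop]
      fun n : ℕ => ((n : ℝ) / Real.Gamma (β + 1)) ^ (1 / (1 + β)) := by
  have hG : 0 < Real.Gamma (β + 1) := Real.Gamma_pos_of_pos (by linarith)
  have hpos : ∀ᶠ n : ℕ in atTop, (0 : ℝ) < ((n : ℝ) / Real.Gamma (β + 1)) ^ (1 / (1 + β)) := by
    filter_upwards [eventually_ge_atTop 1] with n hn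
    have : (0 : ℝ) < n := by exact_mod_cast hn
    positivity
  rw [Asymptotics.isEquivalent_iff_tendsto_one (hpos.mono fun n h => h.ne')]
  have h1 : Tendsto (fun n => ((v n) ^ (β + 1) * expSeries θ (v n) / Real.Gamma (β + 1)) ^
      (-(1 / (1 + β))))
      atTop (𝓝 ((Real.Gamma (β + 1) / Real.Gamma (β + 1)) ^ (-(1 / (1 + β))))) :=
    (((tendsto_expSeries hβ hθ).comp (tendsto_saddlePoint hβ h0 hθ hv)).div_const _).rpow_const
      (Or.inl (by rw [div_self hG.ne']; exact one_ne_zero))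
  rw [div_self hG.ne', Real.one_rpow] at h1
  refine h1.congr' ?_
  filter_upwards [eventually_ge_atTop 1] with n hn
  obtain ⟨hvn, hFn⟩ := (isSaddlePoint_iff hβ hθ _ _).1 (hv n hn)
  have : (0 : ℝ) < n := by exact_mod_cast hn
  rw [hFn, mul_div_assoc, Real.mul_rpow (by positivity) (by positivity), ← Real.rpow_mul hvn.le,
    Pi.div_apply, Real.rpow_neg (by positivity : (0:ℝ) ≤ (n : ℝ) / Real.Gamma (β + 1))]
  have he : (β + 1) * -(1 / (1 + β)) = -1 := by
    have : 1 + β ≠ 0 := by linarith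
    field_simp
    ring
  rw [he, Real.rpow_neg_one]
  exact (div_eq_mul_inv _ _).symm

end SaddlePoint

/-! ### An abstract local limit theorem -/

lemma norm_cexp_taylor_le (x : ℝ) :
    ‖Complex.exp (x * Complex.I) - 1 - x * Complex.I + x ^ 2 / 2‖ ≤ 4 * |x| ^ 3 := by
  have hx : ‖(x : ℂ) * Complex.I‖ = |x| := by simp
  rcases le_total |x| 1 with h | h
  · have := Complex.exp_bound (x := x * Complex.I) (by rwa [hx]) (n := 3) (by norm_num)
    rw [hx] at this
    have he : Complex.exp (x * Complex.I) - 1 - x * Complex.I + x ^ 2 / 2 =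
        Complex.exp (x * Complex.I) - ∑ m ∈ Finset.range 3, (x * Complex.I) ^ m / m.factorial := by
      simp [Finset.sum_range_succ, Nat.factorial, mul_pow]
      ring
    rw [he]
    refine this.trans ?_
    rw [mul_comm]
    gcongr
    norm_num [Nat.factorial]
  · have h1 : 1 ≤ |x| ^ 3 := one_le_pow₀ h
    have h2 : |x| ≤ |x| ^ 3 := le_self_pow₀ h (by norm_num)
    have h3 : |x| ^ 2 ≤ |x| ^ 3 := pow_le_pow_right₀ h (by norm_num)
    calc ‖Complex.exp (x * Complex.I) - 1 - x * Complex.I + x ^ 2 / 2‖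
        ≤ ‖Complex.exp (x * Complex.I)‖ + ‖(1 : ℂ)‖ + ‖x * Complex.I‖ + ‖(x : ℂ) ^ 2 / 2‖ :=
          (norm_add_le _ _).trans (add_le_add_left ((norm_sub_le _ _).trans
            (add_le_add_left (norm_sub_le _ _) _)) _)
      _ = 1 + 1 + |x| + |x| ^ 2 / 2 := by
          rw [Complex.norm_exp_ofReal_mul_I, hx]
          simp
      _ ≤ _ := by linarith

/-- A local limit theorem for `∑ k Z_k`, with `Z_k` independent Poisson variables of parameters
`a n k`, on the scale `τ`.  The target `N n` is close to the mean (`h1`), the variance is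
asymptotic to `V τ ^ 2` (`h2`), the third central moment is negligible (`h3`), and `hdom` bounds the
modulus of the characteristic function on the whole period, uniformly in `n`. -/
theorem tendsto_partsSum {s : ℕ → Finset ℕ} {a : ℕ → ℕ → ℝ} {τ : ℕ → ℝ} {N : ℕ → ℕ} {V : ℝ}
    {B : ℝ → ℝ} (hs : ∀ n, ∀ k ∈ s n, 0 < k) (hτ : Tendsto τ atTop atTop)
    (h1 : Tendsto (fun n => (∑ k ∈ s n, k * a n k - N n) / τ n) atTop (𝓝 0))
    (h2 : Tendsto (fun n => (∑ k ∈ s n, (k : ℝ) ^ 2 * a n k) / τ n ^ 2) atTop (𝓝 V))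
    (h3 : Tendsto (fun n => (∑ k ∈ s n, (k : ℝ) ^ 3 * |a n k|) / τ n ^ 3) atTop (𝓝 0))
    (hB : Integrable B) (hB0 : ∀ u, 0 ≤ B u)
    (hdom : ∀ᶠ n in atTop, ∀ u, |u| ≤ Real.pi * τ n →
      Real.exp (-∑ k ∈ s n, a n k * (1 - Real.cos (k * (u / τ n)))) ≤ B u) :
    Tendsto (fun n => τ n * (Real.exp (-∑ k ∈ s n, a n k) * partsSum (s n) (a n) (N n))) atTop
      (𝓝 ((2 * Real.pi)⁻¹ * ∫ u : ℝ, Real.exp (-(V / 2) * u ^ 2))) := by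
  -- The characteristic exponent of the centred variable, as a function of `t = u / τ`.
  set e : ℕ → ℝ → ℂ := fun n t => ∑ k ∈ s n, (a n k : ℂ) * (Complex.exp (k * t * Complex.I) - 1) -
    N n * t * Complex.I with he
  set F : ℕ → ℝ → ℂ := fun n => (Set.Ioc (-(Real.pi * τ n)) (Real.pi * τ n)).indicator
    fun u => Complex.exp (e n (u / τ n)) with hF
  have hec : ∀ n, Continuous (e n) := fun n => by fun_prop
  have hlim : Tendsto (fun n => ∫ u, F n u) atTop
      (𝓝 (∫ u : ℝ, Complex.exp ((-(V / 2) * u ^ 2 : ℝ) : ℂ))) := by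
    refine tendsto_integral_filter_of_dominated_convergence B ?_ ?_ hB ?_
    · refine Eventually.of_forall fun n => ?_
      refine AEStronglyMeasurable.indicator ?_ measurableSet_Ioc
      exact (Complex.continuous_exp.comp ((hec n).comp (by fun_prop))).aestronglyMeasurable
    · filter_upwards [hdom, hτ.eventually_gt_atTop 0] with n hn hτn
      refine Eventually.of_forall fun u => ?_
      by_cases hu : u ∈ Set.Ioc (-(Real.pi * τ n)) (Real.pi * τ n)
      · rw [hF]
        dsimp only
        rw [Set.indicator_of_mem hu, Complex.norm_exp]
        refine le_trans (le_of_eq ?_) (hn u (abs_le.2 ⟨hu.1.le, hu.2⟩))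
        congr 1
        rw [he]
        dsimp only
        rw [Complex.sub_re, Complex.re_sum, ← Finset.sum_neg_distrib]
        have h0 : ((N n : ℂ) * ((u / τ n : ℝ) : ℂ) * Complex.I).re = 0 := by
          rw [show (N n : ℂ) * ((u / τ n : ℝ) : ℂ) * Complex.I = ((N n * (u / τ n) : ℝ) : ℂ) *
            Complex.I by
            push_cast; ring]
          simp
        rw [h0, sub_zero]
        refine Finset.sum_congr rfl fun k _ => ?_
        rw [Complex.re_ofReal_mul, Complex.sub_re,
          show (k : ℂ) * ((u / τ n : ℝ) : ℂ) * Complex.I = ((k * (u / τ n) : ℝ) : ℂ) * Complex.I by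
            push_cast; ring, Complex.exp_ofReal_mul_I_re, Complex.one_re]
        ring
      · rw [hF]
        dsimp only
        rw [Set.indicator_of_notMem hu, norm_zero]
        exact hB0 u
    · refine Eventually.of_forall fun u => ?_
      have hexp : Tendsto (fun n => e n (u / τ n)) atTop (𝓝 ((-(V / 2) * u ^ 2 : ℝ) : ℂ)) := by
        -- The second-order Taylor expansion of the exponent, with an error from the third moment.
        have hR : Tendsto (fun n => e n (u / τ n) -
            (((u * ((∑ k ∈ s n, k * a n k - N n) / τ n) : ℝ) : ℂ) * Complex.I -
            ((u ^ 2 / 2 * ((∑ k ∈ s n, (k : ℝ) ^ 2 * a n k) / τ n ^ 2) : ℝ) : ℂ))) atTop (𝓝 0) := by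
          have hb : Tendsto (fun n => 4 * |u| ^ 3 *
              ((∑ k ∈ s n, (k : ℝ) ^ 3 * |a n k|) / τ n ^ 3)) atTop (𝓝 0) := by
            simpa using h3.const_mul (4 * |u| ^ 3)
          refine squeeze_zero_norm' ?_ hb
          filter_upwards [hτ.eventually_gt_atTop 0] with n hτn
          have hid : e n (u / τ n) -
            (((u * ((∑ k ∈ s n, k * a n k - N n) / τ n) : ℝ) : ℂ) * Complex.I -
            ((u ^ 2 / 2 * ((∑ k ∈ s n, (k : ℝ) ^ 2 * a n k) / τ n ^ 2) : ℝ) : ℂ)) =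
            ∑ k ∈ s n, (a n k : ℂ) * (Complex.exp ((k * (u / τ n) : ℝ) * Complex.I) - 1 -
              (k * (u / τ n) : ℝ) * Complex.I + ((k * (u / τ n) : ℝ) : ℂ) ^ 2 / 2) := by
            rw [he]
            dsimp only
            have h4 : (((u * ((∑ k ∈ s n, k * a n k - N n) / τ n) : ℝ) : ℂ) * Complex.I) =
                ∑ k ∈ s n, (a n k : ℂ) * ((k * (u / τ n) : ℝ) * Complex.I) -
                N n * ((u / τ n : ℝ) : ℂ) * Complex.I := by
              push_cast
              rw [sub_div, mul_sub, sub_mul, Finset.sum_div, Finset.mul_sum, Finset.sum_mul]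
              congr 1
              · refine Finset.sum_congr rfl fun k _ => by ring
              · ring
            have h5 : ((u ^ 2 / 2 * ((∑ k ∈ s n, (k : ℝ) ^ 2 * a n k) / τ n ^ 2) : ℝ) : ℂ) =
                ∑ k ∈ s n, (a n k : ℂ) * (((k * (u / τ n) : ℝ) : ℂ) ^ 2 / 2) := by
              push_cast
              rw [Finset.sum_div, Finset.mul_sum]
              refine Finset.sum_congr rfl fun k _ => by ring
            rw [h4, h5, sub_sub_eq_add_sub, sub_add_eq_add_sub, sub_sub_sub_cancel_right,
              ← Finset.sum_add_distrib, ← Finset.sum_sub_distrib]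
            refine Finset.sum_congr rfl fun k _ => ?_
            push_cast
            ring
          rw [hid]
          refine (norm_sum_le _ _).trans ?_
          rw [Finset.sum_div, Finset.mul_sum]
          refine Finset.sum_le_sum fun k _ => ?_
          rw [norm_mul, Complex.norm_real, Real.norm_eq_abs]
          refine (mul_le_mul_of_nonneg_left (norm_cexp_taylor_le _) (abs_nonneg _)).trans
            (le_of_eq ?_)
          rw [abs_mul, abs_div, Nat.abs_cast, abs_of_pos hτn]
          ring
        have hM : Tendsto (fun n => (((u * ((∑ k ∈ s n, k * a n k - N n) / τ n) : ℝ) : ℂ) *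
            Complex.I -
            ((u ^ 2 / 2 * ((∑ k ∈ s n, (k : ℝ) ^ 2 * a n k) / τ n ^ 2) : ℝ) : ℂ))) atTop
            (𝓝 (((u * 0 : ℝ) : ℂ) * Complex.I - ((u ^ 2 / 2 * V : ℝ) : ℂ))) :=
          (((Complex.continuous_ofReal.tendsto _).comp (h1.const_mul u)).mul_const _).sub
            ((Complex.continuous_ofReal.tendsto _).comp (h2.const_mul (u ^ 2 / 2)))
        have := hR.add hM
        simp only [sub_add_cancel] at this
        convert this using 2
        push_cast
        ring
      refine ((Complex.continuous_exp.tendsto _).comp hexp).congr' ?_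
      filter_upwards [hτ.eventually_gt_atTop |u|, hτ.eventually_gt_atTop 0] with n hn hτn
      have hlt : |u| < Real.pi * τ n := by nlinarith [Real.pi_gt_three]
      rw [hF]
      dsimp only
      rw [Set.indicator_of_mem (Set.mem_Ioc.2 ⟨(abs_lt.1 hlt).1, (abs_lt.1 hlt).2.le⟩)]
      rfl
  -- The change of variables `u = τ t` in Fourier inversion.
  have hreal : ∀ᶠ n in atTop, ∫ u, F n u =
      ((2 * Real.pi * (τ n * (Real.exp (-∑ k ∈ s n, a n k) * partsSum (s n) (a n) (N n))) : ℝ) :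
        ℂ) := by
    filter_upwards [hτ.eventually_gt_atTop 0] with n hτn
    have hπτ : -(Real.pi * τ n) ≤ Real.pi * τ n := by nlinarith [Real.pi_pos]
    rw [hF]
    dsimp only
    rw [integral_indicator measurableSet_Ioc, ← intervalIntegral.integral_of_le hπτ,
      intervalIntegral.integral_comp_div (fun t => Complex.exp (e n t)) hτn.ne',
      neg_div, mul_div_cancel_right₀ _ hτn.ne']
    have hsplit : ∀ t : ℝ, Complex.exp (e n t) = (Real.exp (-∑ k ∈ s n, a n k) : ℂ) *
        (Complex.exp (∑ k ∈ s n, (a n k : ℂ) * Complex.exp (k * t * Complex.I)) *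
        Complex.exp (-(N n * t * Complex.I))) := by
      intro t
      rw [Complex.ofReal_exp, ← Complex.exp_add, ← Complex.exp_add, he]
      congr 1
      simp only [mul_sub, Finset.sum_sub_distrib, mul_one]
      push_cast
      ring
    rw [intervalIntegral.integral_congr (fun t _ => hsplit t), intervalIntegral.integral_const_mul,
      integral_exp_sum _ (hs n), Complex.real_smul]
    push_cast
    ring
  have hlim' := (hlim.congr' hreal)
  have hint : (∫ u : ℝ, Complex.exp ((-(V / 2) * u ^ 2 : ℝ) : ℂ)) =
      ((∫ u : ℝ, Real.exp (-(V / 2) * u ^ 2) : ℝ) : ℂ) := by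
    simp_rw [← Complex.ofReal_exp]
    exact integral_ofReal
  rw [hint] at hlim'
  have hre := (Complex.continuous_re.tendsto _).comp hlim'
  simp only [Function.comp_def, Complex.ofReal_re] at hre
  have := hre.const_mul (2 * Real.pi)⁻¹
  refine this.congr fun n => ?_
  rw [← mul_assoc, inv_mul_cancel₀ (by positivity), one_mul]

/-! ### Trigonometric bounds and truncated series -/

/-- A bound on the Dirichlet kernel over an arbitrary window. -/
lemma abs_mul_abs_sum_cos_le {t : ℝ} (ht : |t| ≤ Real.pi) {m n : ℕ} (hmn : m ≤ n) :
    |t| * |∑ k ∈ Finset.Ico m n, Real.cos (k * t)| ≤ Real.pi := by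
  -- Multiplying by `2 sin (t / 2)` makes the sum of cosines telescope.
  have htel : ∀ k : ℕ, 2 * Real.sin (t / 2) * Real.cos (k * t) =
      Real.sin (((k + 1 : ℕ) - 1 / 2 : ℝ) * t) - Real.sin ((k - 1 / 2 : ℝ) * t) := by
    intro k
    push_cast
    rw [show ((k : ℝ) + 1 - 1 / 2) * t = k * t + t / 2 by ring,
      show ((k : ℝ) - 1 / 2) * t = k * t - t / 2 by ring, Real.sin_add, Real.sin_sub]
    ring
  have hsum : 2 * Real.sin (t / 2) * ∑ k ∈ Finset.Ico m n, Real.cos (k * t) =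
      Real.sin ((n - 1 / 2 : ℝ) * t) - Real.sin ((m - 1 / 2 : ℝ) * t) := by
    rw [Finset.mul_sum, Finset.sum_congr rfl fun k _ => htel k]
    exact Finset.sum_Ico_sub (fun k : ℕ => Real.sin ((k - 1 / 2 : ℝ) * t)) hmn
  have h2 : |2 * Real.sin (t / 2) * ∑ k ∈ Finset.Ico m n, Real.cos (k * t)| ≤ 2 := by
    rw [hsum]
    refine (abs_sub _ _).trans ?_
    linarith [Real.abs_sin_le_one ((n - 1 / 2 : ℝ) * t), Real.abs_sin_le_one ((m - 1 / 2 : ℝ) * t)]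
  -- Jordan's inequality, applied at `t / 2`, which lies in `[-π / 2, π / 2]`.
  have h3 := Real.mul_abs_le_abs_sin (x := t / 2) (by rw [abs_div, abs_two]; linarith)
  rw [abs_mul, abs_mul, abs_two] at h2
  rw [abs_div, abs_two] at h3
  have h4 : |t| ≤ Real.pi * |Real.sin (t / 2)| := by
    have := mul_le_mul_of_nonneg_left h3 Real.pi_pos.le
    field_simp at this
    linarith
  have h5 : 0 ≤ |∑ k ∈ Finset.Ico m n, Real.cos (k * t)| := abs_nonneg _
  nlinarith [mul_le_mul_of_nonneg_right h4 h5, Real.pi_pos]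

/-- Over the window `[M, 4M)`, the sum of `1 - cos (k t)` is quadratic in `t` as long as
`2 M |t| ≤ π`, and beyond that it is at least of the order of its length. -/
lemma sum_one_sub_cos_ge {t : ℝ} (ht : |t| ≤ Real.pi) (M : ℕ) :
    2 / Real.pi ^ 2 * (M : ℝ) ^ 3 * t ^ 2 ≤ ∑ k ∈ Finset.Ico M (4 * M), (1 - Real.cos (k * t)) ∨
    (M : ℝ) ≤ ∑ k ∈ Finset.Ico M (4 * M), (1 - Real.cos (k * t)) := by
  have hπ := Real.pi_pos
  rcases le_total (2 * M * |t|) Real.pi with h | h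
  -- For `2 M |t| ≤ π`, each term with `M ≤ k < 2 M` is at least `2 (k t) ^ 2 / π ^ 2`.
  · left
    calc 2 / Real.pi ^ 2 * (M : ℝ) ^ 3 * t ^ 2
        = ∑ k ∈ Finset.Ico M (2 * M), 2 / Real.pi ^ 2 * (M * t) ^ 2 := by
          rw [Finset.sum_const, Nat.card_Ico, nsmul_eq_mul, show 2 * M - M = M by lia]
          ring
      _ ≤ ∑ k ∈ Finset.Ico M (2 * M), (1 - Real.cos (k * t)) := by
          refine Finset.sum_le_sum fun k hk => ?_
          rw [Finset.mem_Ico] at hk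
          have hk1 : (M : ℝ) ≤ k := by exact_mod_cast hk.1
          have hk2 : (k : ℝ) ≤ 2 * M := by exact_mod_cast hk.2.le
          have := Real.cos_le_one_sub_mul_cos_sq (x := k * t) (by
            rw [abs_mul, Nat.abs_cast]
            exact (mul_le_mul_of_nonneg_right hk2 (abs_nonneg t)).trans h)
          have h6 : 2 / Real.pi ^ 2 * (M * t) ^ 2 ≤ 2 / Real.pi ^ 2 * (k * t) ^ 2 := by
            rw [mul_pow, mul_pow]
            gcongr
          linarith
      _ ≤ _ := by
          refine Finset.sum_le_sum_of_subset_of_nonneg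
            (Finset.Ico_subset_Ico_right (by lia)) fun k _ _ => ?_
          linarith [Real.cos_le_one (k * t)]
  -- Otherwise the cosines sum to at most `2 M` over the `3 M` terms.
  · right
    have h1 := abs_mul_abs_sum_cos_le ht (m := M) (n := 4 * M) (by lia)
    have ht0 : 0 < |t| := by
      by_contra! h0
      have : |t| = 0 := le_antisymm h0 (abs_nonneg t)
      rw [this, mul_zero] at h
      linarith
    have h2 : |∑ k ∈ Finset.Ico M (4 * M), Real.cos (k * t)| ≤ 2 * M := by
      refine le_of_mul_le_mul_left (a := |t|) ?_ ht0
      linarith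
    rw [Finset.sum_sub_distrib, Finset.sum_const, Nat.card_Ico, nsmul_eq_mul, mul_one,
      show 4 * M - M = 3 * M by lia]
    push_cast
    linarith [(abs_le.1 h2).2]

/-- The partial sum `∑_{1 ≤ k < b} θ_k e^{-k v}` of the exponential series. -/
noncomputable def truncSeries (θ : ℕ → ℝ) (b : ℕ) (v : ℝ) : ℝ :=
  ∑ k ∈ Finset.Ico 1 b, θ k * Real.exp (-(k : ℝ) * v)

/-- The tail of the series at `v` is a small multiple of the whole series at `v / 4`, by splitting
`e^{-k v} = e^{-3 k v / 4} e^{-k v / 4}`. -/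
lemma truncSeries_tail {θ : ℕ → ℝ} {β v : ℝ} (hβ : 0 ≤ β) (h0 : ∀ k : ℕ, 1 ≤ k → 0 ≤ θ k)
    (hθ : θ ~[atTop] fun k : ℕ => (k : ℝ) ^ β) (hv : 0 < v) (b : ℕ) :
    0 ≤ expSeries θ v - truncSeries θ b v ∧
    expSeries θ v - truncSeries θ b v ≤ Real.exp (-(3 / 4 * (v * b))) * expSeries θ (v / 4) := by
  obtain ⟨f, hf⟩ : ∃ f : ℝ → ℕ → ℝ, f = fun w k => θ (k + 1) * Real.exp (-((k + 1 : ℕ) : ℝ) * w) :=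
    ⟨_, rfl⟩
  have hE : ∀ w, expSeries θ w = ∑' k, f w k := fun w => by rw [hf]; rfl
  have hsum : ∀ w, 0 < w → Summable (f w) := fun w hw => by
    rw [hf]; exact summable_mul_exp hβ hθ hw
  have hnn : ∀ w k, 0 ≤ f w k := fun w k => by
    rw [hf]; exact mul_nonneg (h0 _ (by lia)) (Real.exp_pos _).le
  have hs := hsum v hv
  have hs4 := hsum (v / 4) (by positivity)
  have ht : truncSeries θ b v = ∑ k ∈ Finset.range (b - 1), f v k := by
    rw [truncSeries, Finset.sum_Ico_eq_sum_range, hf]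
    refine Finset.sum_congr rfl fun k _ => ?_
    rw [add_comm 1 k]
  have htail : expSeries θ v - truncSeries θ b v = ∑' k, f v (k + (b - 1)) := by
    rw [ht, hE, ← hs.sum_add_tsum_nat_add (b - 1)]
    ring
  refine ⟨by rw [htail]; exact tsum_nonneg fun k => hnn v _, ?_⟩
  have h4 : ∑' k, f (v / 4) (k + (b - 1)) ≤ expSeries θ (v / 4) := by
    rw [hE, ← hs4.sum_add_tsum_nat_add (b - 1)]
    exact le_add_of_nonneg_left (Finset.sum_nonneg fun k _ => hnn _ _)
  rw [htail]
  refine le_trans ?_ (mul_le_mul_of_nonneg_left h4 (Real.exp_pos _).le)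
  rw [← tsum_mul_left]
  refine Summable.tsum_le_tsum (fun k => ?_) ((summable_nat_add_iff (b - 1)).2 hs)
    (((summable_nat_add_iff (b - 1)).2 hs4).mul_left _)
  have hb : (b : ℝ) ≤ ((k + (b - 1) + 1 : ℕ) : ℝ) := Nat.cast_le.2 (by lia)
  have hθk := h0 (k + (b - 1) + 1) (by lia)
  rw [hf]
  dsimp only
  rw [mul_left_comm, ← Real.exp_add]
  refine mul_le_mul_of_nonneg_left (Real.exp_le_exp.2 ?_) hθk
  nlinarith

section Asymptotics

variable {α : ℝ} {v : ℕ → ℝ} {b : ℕ → ℕ}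

/-- Truncating at `b ≥ (3 / 4) α log (1 / v) / v` costs only `o(v ^ (-(β + 1) + α / 2))`.  For
`β = α` this is `o(v ^ (-(1 + α / 2)))`, the scale of the fluctuations of the total size. -/
lemma tendsto_tail {θ : ℕ → ℝ} {β : ℝ} (hα : 0 < α) (hβ : 0 ≤ β) (h0 : ∀ k : ℕ, 1 ≤ k → 0 ≤ θ k)
    (hθ : θ ~[atTop] fun k : ℕ => (k : ℝ) ^ β) (hv : Tendsto v atTop (𝓝[>] 0))
    (hb : ∀ᶠ n in atTop, 3 / 4 * α * Real.log (v n)⁻¹ ≤ v n * b n) :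
    Tendsto (fun n => v n ^ (β + 1 - α / 2) * (expSeries θ (v n) - truncSeries θ (b n) (v n)))
      atTop (𝓝 0) := by
  have hv0 : ∀ᶠ n in atTop, 0 < v n := hv.eventually self_mem_nhdsWithin
  have hv' : Tendsto v atTop (𝓝 0) := hv.mono_right nhdsWithin_le_nhds
  have hv4 : Tendsto (fun n => v n / 4) atTop (𝓝[>] 0) := by
    refine tendsto_nhdsWithin_iff.2 ⟨by simpa using hv'.div_const 4, ?_⟩
    filter_upwards [hv0] with n hn using by simpa using hn
  -- The exponent `3 / 4` occurs twice, which gives `v ^ (9 α / 16)` and leaves a spare factor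
  -- `v ^ (α / 16)` over the required `v ^ (α / 2)`.
  have h1 : Tendsto (fun n => v n ^ (α / 16) *
      (4 ^ (β + 1) * ((v n / 4) ^ (β + 1) * expSeries θ (v n / 4))))
      atTop (𝓝 (0 * (4 ^ (β + 1) * Real.Gamma (β + 1)))) := by
    refine Tendsto.mul ?_ (((tendsto_expSeries hβ hθ).comp hv4).const_mul _)
    have := hv'.rpow_const (p := α / 16) (Or.inr (by positivity))
    rwa [Real.zero_rpow (by positivity)] at this
  rw [zero_mul] at h1
  refine squeeze_zero' ?_ ?_ h1
  · filter_upwards [hv0] with n hn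
    exact mul_nonneg (Real.rpow_nonneg hn.le _) (truncSeries_tail hβ h0 hθ hn _).1
  · filter_upwards [hv0, hb] with n hn hbn
    have hE := (truncSeries_tail hβ h0 hθ hn (b n)).2
    have hexp : Real.exp (-(3 / 4 * (v n * b n))) ≤ v n ^ (9 / 16 * α) := by
      rw [Real.rpow_def_of_pos hn]
      refine Real.exp_le_exp.2 ?_
      rw [Real.log_inv] at hbn
      linarith
    have hF := expSeries_nonneg h0 (v n / 4)
    calc v n ^ (β + 1 - α / 2) * (expSeries θ (v n) - truncSeries θ (b n) (v n))
        ≤ v n ^ (β + 1 - α / 2) * (v n ^ (9 / 16 * α) * expSeries θ (v n / 4)) := by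
          refine mul_le_mul_of_nonneg_left (hE.trans ?_) (Real.rpow_nonneg hn.le _)
          exact mul_le_mul_of_nonneg_right hexp hF
      _ = _ := by
          rw [← mul_assoc, ← Real.rpow_add hn, Real.div_rpow hn.le (by norm_num)]
          have : (4 : ℝ) ^ (β + 1) ≠ 0 := (Real.rpow_pos_of_pos (by norm_num) _).ne'
          rw [show β + 1 - α / 2 + 9 / 16 * α = α / 16 + (β + 1) by ring, Real.rpow_add hn]
          field_simp

lemma tendsto_truncSeries {θ : ℕ → ℝ} {β : ℝ} (hα : 0 < α) (hβ : 0 ≤ β)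
    (h0 : ∀ k : ℕ, 1 ≤ k → 0 ≤ θ k)
    (hθ : θ ~[atTop] fun k : ℕ => (k : ℝ) ^ β) (hv : Tendsto v atTop (𝓝[>] 0))
    (hb : ∀ᶠ n in atTop, 3 / 4 * α * Real.log (v n)⁻¹ ≤ v n * b n) :
    Tendsto (fun n => v n ^ (β + 1) * truncSeries θ (b n) (v n))
      atTop (𝓝 (Real.Gamma (β + 1))) := by
  have hv0 : ∀ᶠ n in atTop, 0 < v n := hv.eventually self_mem_nhdsWithin
  have hv' : Tendsto v atTop (𝓝 0) := hv.mono_right nhdsWithin_le_nhds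
  have h2 := hv'.rpow_const (p := α / 2) (Or.inr (by positivity))
  rw [Real.zero_rpow (by positivity)] at h2
  have h3 := ((tendsto_expSeries hβ hθ).comp hv).sub (h2.mul (tendsto_tail hα hβ h0 hθ hv hb))
  rw [mul_zero, sub_zero] at h3
  refine h3.congr' ?_
  filter_upwards [hv0] with n hn
  rw [← mul_assoc, ← Real.rpow_add hn, show α / 2 + (β + 1 - α / 2) = β + 1 by ring]
  simp only [Function.comp]
  ring

/-- The intensity `θ_k e^{-k v} / k` of cycles of length `k` after tilting by `e^{-v}`.  The value
at `k = 0` is `0`, by division by zero. -/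
noncomputable def cycleRate (θ : ℕ → ℝ) (v : ℝ) (k : ℕ) : ℝ :=
  θ k / k * Real.exp (-v) ^ k

lemma cycleRate_nonneg {θ : ℕ → ℝ} (h0 : ∀ k : ℕ, 1 ≤ k → 0 ≤ θ k) (v : ℝ) (k : ℕ) :
    0 ≤ cycleRate θ v k := by
  rcases Nat.eq_zero_or_pos k with rfl | hk
  · simp [cycleRate]
  · have := h0 k hk
    unfold cycleRate
    positivity

lemma pow_succ_mul_cycleRate (θ : ℕ → ℝ) (v : ℝ) {k : ℕ} (hk : 1 ≤ k) (p : ℕ) :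
    (k : ℝ) ^ (p + 1) * cycleRate θ v k = (k : ℝ) ^ p * θ k * Real.exp (-(k : ℝ) * v) := by
  have : (k : ℝ) ≠ 0 := by positivity
  rw [cycleRate, ← Real.exp_nat_mul, pow_succ, show -(k : ℝ) * v = k * -v by ring]
  field_simp

lemma sum_pow_mul_cycleRate (θ : ℕ → ℝ) (v : ℝ) (b p : ℕ) :
    ∑ k ∈ Finset.Ico 1 b, (k : ℝ) ^ (p + 1) * cycleRate θ v k =
      truncSeries (fun k => (k : ℝ) ^ p * θ k) b v :=
  Finset.sum_congr rfl fun _ hk => pow_succ_mul_cycleRate θ v (Finset.mem_Ico.1 hk).1 p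

end Asymptotics

/-! ### The local limit theorem for the cycle rates -/

section LocalLimit

variable {α : ℝ} {θ : ℕ → ℝ} {v : ℕ → ℝ} {b : ℕ → ℕ}

lemma tendsto_mul_index_atTop (hα : 0 < α) (hv : Tendsto v atTop (𝓝[>] 0))
    (hb : ∀ᶠ n in atTop, 3 / 4 * α * Real.log (v n)⁻¹ ≤ v n * b n) :
    Tendsto (fun n => v n * b n) atTop atTop := by
  have h1 : Tendsto (fun n => Real.log (v n)⁻¹) atTop atTop :=
    Real.tendsto_log_atTop.comp (tendsto_inv_nhdsGT_zero.comp hv)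
  exact tendsto_atTop_mono' _ hb (h1.const_mul_atTop (by positivity))

lemma cycleRate_ge (hα : 0 < α) {w : ℝ} (hw : 0 < w) {k : ℕ} (hk1 : 1 / w ≤ k)
    (hk2 : k ≤ 8 / w) (hθ : 1 / 2 * (k : ℝ) ^ α ≤ θ k) :
    Real.exp (-8) / 16 * w ^ (1 - α) ≤ cycleRate θ w k := by
  have hk : (0 : ℝ) < k := lt_of_lt_of_le (by positivity) hk1
  have h1 : w ^ (-α) ≤ (k : ℝ) ^ α := by
    rw [Real.rpow_neg hw.le, ← Real.inv_rpow hw.le]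
    exact Real.rpow_le_rpow (by positivity) (by simpa using hk1) hα.le
  have h2 : w / 8 ≤ 1 / (k : ℝ) := by
    rw [le_div_iff₀ hw] at hk2
    rw [div_le_div_iff₀ (by norm_num) hk]
    linarith
  have h3 : Real.exp (-8) ≤ Real.exp (-w) ^ k := by
    rw [← Real.exp_nat_mul]
    refine Real.exp_le_exp.2 ?_
    rw [le_div_iff₀ hw] at hk2
    linarith
  calc Real.exp (-8) / 16 * w ^ (1 - α) = (1 / 2 * w ^ (-α)) * (w / 8) * Real.exp (-8) := by
        rw [sub_eq_add_neg, Real.rpow_add hw, Real.rpow_one]; ring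
    _ ≤ (1 / 2 * (k : ℝ) ^ α) * (1 / (k : ℝ)) * Real.exp (-w) ^ k := by gcongr
    _ ≤ θ k * (1 / (k : ℝ)) * Real.exp (-w) ^ k := by gcongr
    _ = _ := by rw [cycleRate]; ring

lemma tendsto_rpow_mul_exp_neg_rpow (hα : 0 < α) {c : ℝ} (hc : 0 < c) (D : ℝ) :
    Tendsto (fun w : ℝ => (1 + D * w ^ (-(2 + α))) * Real.exp (-(c * w ^ (-α))))
      (𝓝[>] 0) (𝓝 0) := by
  have h0 : Tendsto (fun w : ℝ => w ^ (-α)) (𝓝[>] 0) atTop :=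
    tendsto_rpow_neg_nhdsGT_zero (by linarith)
  have h1 := (tendsto_rpow_mul_exp_neg_mul_atTop_nhds_zero ((2 + α) / α) c hc).comp h0
  have h2 := (tendsto_rpow_mul_exp_neg_mul_atTop_nhds_zero 0 c hc).comp h0
  have h3 := h2.add (h1.const_mul D)
  rw [mul_zero, add_zero] at h3
  refine h3.congr' ?_
  filter_upwards [self_mem_nhdsWithin] with w (hw : 0 < w)
  simp only [Function.comp]
  rw [Real.rpow_zero, ← Real.rpow_mul hw.le, show -α * ((2 + α) / α) = -(2 + α) by field_simp]
  ring_nf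

lemma integrable_dominating {c : ℝ} (hc : 0 < c) :
    Integrable fun u : ℝ => Real.exp (-c * u ^ 2) + (1 + u ^ 2)⁻¹ :=
  (integrable_exp_neg_mul_sq hc).add integrable_inv_one_add_sq

/-- The modulus of the characteristic function of the total size is dominated by an integrable
function that does not depend on `n`.  Only the lengths between about `1 / v` and `8 / v` are used:
their rates are at least a constant times `v ^ (1 - α)`. -/
lemma eventually_charFun_le (hα : 0 < α) (h0 : ∀ k : ℕ, 1 ≤ k → 0 ≤ θ k)
    (hθ : θ ~[atTop] fun k : ℕ => (k : ℝ) ^ α) (hv : Tendsto v atTop (𝓝[>] 0))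
    (hb : ∀ᶠ n in atTop, 3 / 4 * α * Real.log (v n)⁻¹ ≤ v n * b n) :
    ∀ᶠ n in atTop, ∀ u, |u| ≤ Real.pi * v n ^ (-(1 + α / 2)) →
      Real.exp (-∑ k ∈ Finset.Ico 1 (b n), cycleRate θ (v n) k *
        (1 - Real.cos (k * (u / v n ^ (-(1 + α / 2)))))) ≤
      Real.exp (-(Real.exp (-8) / 16 * (2 / Real.pi ^ 2)) * u ^ 2) + (1 + u ^ 2)⁻¹ := by
  have hv0 : ∀ᶠ n in atTop, 0 < v n := hv.eventually self_mem_nhdsWithin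
  have hv' : Tendsto v atTop (𝓝 0) := hv.mono_right nhdsWithin_le_nhds
  have hinv : Tendsto (fun n => (v n)⁻¹) atTop atTop := tendsto_inv_nhdsGT_zero.comp hv
  obtain ⟨k₀, hk₀⟩ := eventually_atTop.1 (eventually_half_rpow_le hθ)
  set c : ℝ := Real.exp (-8) / 16
  have hcpos : 0 < c := by positivity
  have hsmall := ((tendsto_rpow_mul_exp_neg_rpow hα hcpos
      (Real.pi ^ 2)).comp hv).eventually_le_const
    zero_lt_one
  filter_upwards [hv0, hv'.eventually_le_const zero_lt_one,
    (tendsto_mul_index_atTop hα hv hb).eventually_ge_atTop 8,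
    hinv.eventually_ge_atTop (k₀ : ℝ), hsmall] with n hn hn1 hbn hkn hsm u hu
  have hw : 1 / v n = (v n)⁻¹ := one_div _
  set w := v n
  -- The window `[M, 4 M)` with `1 / v ≤ M ≤ 2 / v` lies between `1 / v` and `8 / v`.
  set M := ⌈1 / w⌉₊
  have hM1 : 1 / w ≤ M := Nat.le_ceil _
  have hM1' : 1 ≤ 1 / w := by rw [le_div_iff₀ hn]; linarith
  have hM2 : (M : ℝ) ≤ 2 / w := by
    have := (Nat.ceil_lt_add_one (show 0 ≤ 1 / w by positivity)).le
    calc (M : ℝ) ≤ 1 / w + 1 := this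
      _ ≤ 1 / w + 1 / w := by linarith
      _ = 2 / w := by ring
  have hMpos : 1 ≤ M := Nat.ceil_pos.2 (by positivity)
  set t := u / w ^ (-(1 + α / 2)) with ht
  have hτ : 0 < w ^ (-(1 + α / 2)) := Real.rpow_pos_of_pos hn _
  have htπ : |t| ≤ Real.pi := by
    rw [ht, abs_div, abs_of_pos hτ, div_le_iff₀ hτ]
    exact hu
  have hτ2 : (w ^ (-(1 + α / 2))) ^ 2 = w ^ (-(2 + α)) := by
    rw [← Real.rpow_natCast, ← Real.rpow_mul hn.le]
    congr 1
    push_cast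
    ring
  have ht2 : t ^ 2 = u ^ 2 * w ^ (2 + α) := by
    rw [ht, div_pow, hτ2, Real.rpow_neg hn.le, div_inv_eq_mul]
  have hsub : Finset.Ico M (4 * M) ⊆ Finset.Ico 1 (b n) := by
    intro k hk
    rw [Finset.mem_Ico] at hk ⊢
    refine ⟨hMpos.trans hk.1, ?_⟩
    have h1 : (k : ℝ) < 4 * M := by exact_mod_cast hk.2
    have h2 : 8 / w ≤ b n := by rw [div_le_iff₀ hn]; linarith
    have h3 : 4 * (2 / w) = 8 / w := by ring
    have : (k : ℝ) < b n := by linarith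
    exact_mod_cast this
  have hsum : c * w ^ (1 - α) * ∑ k ∈ Finset.Ico M (4 * M), (1 - Real.cos (k * t)) ≤
      ∑ k ∈ Finset.Ico 1 (b n), cycleRate θ w k * (1 - Real.cos (k * t)) := by
    rw [Finset.mul_sum]
    refine (Finset.sum_le_sum fun k hk => ?_).trans (Finset.sum_le_sum_of_subset_of_nonneg hsub
      fun k _ _ => mul_nonneg (cycleRate_nonneg h0 _ _) (by linarith [Real.cos_le_one (k * t)]))
    rw [Finset.mem_Ico] at hk
    have hk1 : (M : ℝ) ≤ k := by exact_mod_cast hk.1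
    have hk2 : (k : ℝ) < 4 * M := by exact_mod_cast hk.2
    have h3 : 4 * (2 / w) = 8 / w := by ring
    refine mul_le_mul_of_nonneg_right (cycleRate_ge hα hn (hM1.trans hk1) (by linarith) (hk₀ k ?_))
      (by linarith [Real.cos_le_one (k * t)])
    have : (k₀ : ℝ) ≤ k := by linarith
    exact_mod_cast this
  have hwα : 0 < w ^ (1 - α) := Real.rpow_pos_of_pos hn _
  -- Near the origin the bound is Gaussian.  Elsewhere it is `exp (-c v ^ (-α))`, which is smaller
  -- than any power of `v` and so below `(1 + u ^ 2)⁻¹` for `|u| ≤ π v ^ (-(1 + α / 2))`.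
  rcases sum_one_sub_cos_ge htπ M with h | h
  · refine le_trans (Real.exp_le_exp.2 ?_) (le_add_of_nonneg_right (by positivity))
    have h5 : c * w ^ (1 - α) * (2 / Real.pi ^ 2 * (1 / w) ^ 3 * t ^ 2) ≤
        c * w ^ (1 - α) * ∑ k ∈ Finset.Ico M (4 * M), (1 - Real.cos (k * t)) := by
      refine mul_le_mul_of_nonneg_left (le_trans ?_ h) (by positivity)
      gcongr
    have h6 : c * w ^ (1 - α) * (2 / Real.pi ^ 2 * (1 / w) ^ 3 * t ^ 2) =
        c * (2 / Real.pi ^ 2) * u ^ 2 := by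
      have h7 : w ^ (1 - α) * w ^ (2 + α) = w ^ 3 := by
        rw [← Real.rpow_add hn, ← Real.rpow_natCast]
        congr 1
        push_cast
        ring
      rw [ht2]
      calc _ = c * (2 / Real.pi ^ 2) * u ^ 2 * (w ^ (1 - α) * w ^ (2 + α)) * (1 / w) ^ 3 := by ring
        _ = _ := by rw [h7]; field_simp
    linarith
  · refine le_trans ?_ (le_add_of_nonneg_left (Real.exp_pos _).le)
    have h5 : c * w ^ (-α) ≤ c * w ^ (1 - α) * ∑ k ∈ Finset.Ico M (4 * M),
        (1 - Real.cos (k * t)) := by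
      calc c * w ^ (-α) = c * w ^ (1 - α) * (1 / w) := by
            rw [sub_eq_add_neg, Real.rpow_add hn, Real.rpow_one]
            field_simp
        _ ≤ _ := mul_le_mul_of_nonneg_left (hM1.trans h) (by positivity)
    rw [← one_div, le_div_iff₀ (by positivity), mul_comm]
    refine le_trans ?_ hsm
    have hu2 : u ^ 2 ≤ Real.pi ^ 2 * w ^ (-(2 + α)) := by
      rw [← hτ2, ← mul_pow, ← sq_abs]
      exact pow_le_pow_left₀ (abs_nonneg u) hu 2
    simp only [Function.comp]
    refine mul_le_mul (by linarith) (Real.exp_le_exp.2 (by linarith)) (Real.exp_pos _).le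
      (by positivity)

/-- The value at `0` of the centred Gaussian density of variance `Γ(α + 2)`, written as the inverse
Fourier transform of its characteristic function. -/
noncomputable def gaussConst (α : ℝ) : ℝ :=
  (2 * Real.pi)⁻¹ * ∫ u : ℝ, Real.exp (-(Real.Gamma (α + 2) / 2) * u ^ 2)

lemma gaussConst_pos (hα : 0 < α) : 0 < gaussConst α := by
  have : 0 < Real.Gamma (α + 2) := Real.Gamma_pos_of_pos (by linarith)
  have := Real.pi_pos
  rw [gaussConst, integral_gaussian]
  positivity

/-- The local limit theorem for the cycle rates.  The limit does not depend on the truncation `b`,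
as long as it is not much below the length of the longest cycles. -/
theorem tendsto_partsSum_cycleRate (hα : 0 < α) (h0 : ∀ k : ℕ, 1 ≤ k → 0 ≤ θ k)
    (hθ : θ ~[atTop] fun k : ℕ => (k : ℝ) ^ α) (hv : Tendsto v atTop (𝓝[>] 0))
    (hb : ∀ᶠ n in atTop, 3 / 4 * α * Real.log (v n)⁻¹ ≤ v n * b n) {N : ℕ → ℕ}
    (hN : Tendsto (fun n => v n ^ (1 + α / 2) * (expSeries θ (v n) - N n)) atTop (𝓝 0)) :
    Tendsto (fun n => v n ^ (-(1 + α / 2)) *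
      (Real.exp (-∑ k ∈ Finset.Ico 1 (b n), cycleRate θ (v n) k) *
      partsSum (Finset.Ico 1 (b n)) (cycleRate θ (v n)) (N n))) atTop (𝓝 (gaussConst α)) := by
  have hv0 : ∀ᶠ n in atTop, 0 < v n := hv.eventually self_mem_nhdsWithin
  have hv' : Tendsto v atTop (𝓝 0) := hv.mono_right nhdsWithin_le_nhds
  have h0p : ∀ p : ℕ, ∀ k : ℕ, 1 ≤ k → 0 ≤ (k : ℝ) ^ p * θ k := fun p k hk =>
    mul_nonneg (by positivity) (h0 k hk)
  refine tendsto_partsSum (τ := fun n => v n ^ (-(1 + α / 2)))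
    (fun n k hk => (Finset.mem_Ico.1 hk).1)
    ((tendsto_rpow_neg_nhdsGT_zero (by linarith)).comp hv) ?_ ?_ ?_
    (integrable_dominating (c := Real.exp (-8) / 16 * (2 / Real.pi ^ 2)) (by positivity))
    (fun u => by positivity) (eventually_charFun_le hα h0 hθ hv hb)
  -- The mean: both the distance of `N` to the full series and the truncated tail are negligible.
  · have h := hN.sub (tendsto_tail hα hα.le h0 hθ hv hb)
    rw [sub_zero] at h
    refine h.congr' ?_
    filter_upwards [hv0] with n hn
    have hs := sum_pow_mul_cycleRate θ (v n) (b n) 0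
    simp only [zero_add, pow_one, pow_zero, one_mul] at hs
    rw [hs, Real.rpow_neg hn.le, div_inv_eq_mul, show α + 1 - α / 2 = 1 + α / 2 by ring]
    ring
  -- The variance.
  · have h := tendsto_truncSeries hα (by positivity) (h0p 1) (isEquivalent_pow_mul hθ 1) hv hb
    rw [show α + ((1 : ℕ) : ℝ) + 1 = α + 2 by push_cast; ring] at h
    refine h.congr' ?_
    filter_upwards [hv0] with n hn
    rw [← sum_pow_mul_cycleRate θ (v n) (b n) 1, ← Real.rpow_natCast (v n ^ (-(1 + α / 2))),
      ← Real.rpow_mul hn.le, show -(1 + α / 2) * ((2 : ℕ) : ℝ) = -(α + 2) by push_cast; ring,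
      Real.rpow_neg hn.le, div_inv_eq_mul, mul_comm]
  -- The third central moment, of order `v ^ (-(α + 3)) = o(v ^ (-3 (1 + α / 2)))`.
  · have h := tendsto_truncSeries hα (by positivity) (h0p 2) (isEquivalent_pow_mul hθ 2) hv hb
    have h2 := hv'.rpow_const (p := α / 2) (Or.inr (by positivity))
    rw [Real.zero_rpow (by positivity)] at h2
    have h3 := h2.mul h
    rw [zero_mul] at h3
    refine h3.congr' ?_
    filter_upwards [hv0] with n hn
    rw [← sum_pow_mul_cycleRate θ (v n) (b n) 2, ← Real.rpow_natCast (v n ^ (-(1 + α / 2))),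
      ← Real.rpow_mul hn.le, ← mul_assoc, ← Real.rpow_add hn,
      show α / 2 + (α + ((2 : ℕ) : ℝ) + 1) = -(-(1 + α / 2) * ((3 : ℕ) : ℝ)) by push_cast; ring,
      Real.rpow_neg hn.le, mul_comm, ← div_eq_mul_inv]
    congr 1
    refine Finset.sum_congr rfl fun k _ => ?_
    rw [abs_of_nonneg (cycleRate_nonneg h0 _ _)]

end LocalLimit

/-! ### Probabilities of prescribed longest cycles -/

lemma partsTerm_nonneg {a : ℕ → ℝ} {m : Multiset ℕ} (ha : ∀ k ∈ m, 0 ≤ a k) : 0 ≤ partsTerm a m :=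
  div_nonneg (Multiset.prod_nonneg fun x hx => by
    obtain ⟨k, hk, rfl⟩ := Multiset.mem_map.1 hx
    exact ha k hk) (Finset.prod_nonneg fun _ _ => Nat.cast_nonneg _)

lemma partsTerm_cons (a : ℕ → ℝ) {x : ℕ} {q : Multiset ℕ} (hx : x ∉ q) :
    partsTerm a (x ::ₘ q) = a x * partsTerm a q := by
  rw [partsTerm, partsTerm, Multiset.map_cons, Multiset.prod_cons, Multiset.toFinset_cons,
    Finset.prod_insert (by simpa using hx), Multiset.count_cons_self,
      Multiset.count_eq_zero_of_notMem hx]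
  have : ∏ k ∈ q.toFinset, (((x ::ₘ q).count k).factorial : ℝ) =
      ∏ k ∈ q.toFinset, ((q.count k).factorial : ℝ) := by
    refine Finset.prod_congr rfl fun k hk => ?_
    rw [Multiset.count_cons_of_ne]
    rintro rfl
    exact hx (Multiset.mem_toFinset.1 hk)
  rw [this]
  simp [mul_div_assoc]

/-- Adding distinct new parts multiplies the contribution by their rates. -/
lemma partsTerm_coe_add (a : ℕ → ℝ) {l : List ℕ} {q : Multiset ℕ} (hl : l.Nodup)
    (hlq : ∀ x ∈ l, x ∉ q) :
    partsTerm a ((l : Multiset ℕ) + q) = (l.map a).prod * partsTerm a q := by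
  induction l with
  | nil => simp
  | cons x l ih =>
    rw [List.nodup_cons] at hl
    rw [← Multiset.cons_coe, Multiset.cons_add, partsTerm_cons, ih hl.2 fun y hy =>
      hlq y (by simp [hy]),
      List.map_cons, List.prod_cons, mul_assoc]
    rw [Multiset.mem_add, not_or]
    exact ⟨by simpa using hl.1, hlq x (by simp)⟩

lemma sort_coe_add {l : List ℕ} {q : Multiset ℕ} (hl : l.Pairwise (fun a b => a ≥ b))
    (hlq : ∀ x ∈ l, ∀ y ∈ q, y ≤ x) :
    ((l : Multiset ℕ) + q).sort (fun a b => a ≥ b) = l ++ q.sort (fun a b => a ≥ b) := by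
  refine List.Perm.eq_of_pairwise (le := fun a b => a ≥ b) (fun a b _ _ h1 h2 => le_antisymm h2 h1)
    (Multiset.pairwise_sort _ _) ?_ ?_
  · rw [List.pairwise_append]
    exact ⟨hl, Multiset.pairwise_sort _ _, fun x hx y hy => hlq x hx y (by simpa using hy)⟩
  · rw [← Multiset.coe_eq_coe, Multiset.sort_eq, ← Multiset.coe_add, Multiset.sort_eq]

lemma partsSum_Icc (a : ℕ → ℝ) (n : ℕ) :
    partsSum (Finset.Icc 1 n) a n = ∑ p : n.Partition, partsTerm a p.parts := by
  rw [partsSum, Finset.filter_true_of_mem]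
  exact fun p _ k hk => Finset.mem_Icc.2 ⟨p.parts_pos hk, Nat.Partition.le_of_mem_parts hk⟩

lemma partsTerm_scale (a : ℕ → ℝ) (r : ℝ) {n : ℕ} (p : n.Partition) :
    partsTerm (fun k => a k * r ^ k) p.parts = r ^ n * partsTerm a p.parts := by
  rw [partsTerm, partsTerm, Multiset.prod_map_mul, mul_div_assoc', mul_comm (r ^ n)]
  congr 2
  conv_rhs => rw [← p.parts_sum]
  generalize p.parts = m
  induction m using Multiset.induction with
  | empty => simp
  | cons a m ih => simp [pow_add, ih]

/-- The normalization constant is a partition sum for the tilted rates, whatever the tilt `v`. -/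
lemma exp_mul_normConst (θ : ℕ → ℝ) (n : ℕ) (v : ℝ) :
    Real.exp (-v) ^ n * normConst θ n = partsSum (Finset.Icc 1 n) (cycleRate θ v) n := by
  have h := sum_perm_weight θ n fun _ => 1
  simp only [one_mul] at h
  have hn : (n.factorial : ℝ) ≠ 0 := by exact_mod_cast n.factorial_ne_zero
  rw [normConst, h, one_div, ← mul_assoc (n.factorial : ℝ)⁻¹, inv_mul_cancel₀ hn, one_mul,
    partsSum_Icc, Finset.mul_sum]
  exact Finset.sum_congr rfl fun p _ => (partsTerm_scale _ _ p).symm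

lemma permProb_nonneg {θ : ℕ → ℝ} (h0 : ∀ k : ℕ, 1 ≤ k → 0 ≤ θ k) {n : ℕ} (hn : 0 < normConst θ n)
    (σ : Equiv.Perm (Fin n)) : 0 ≤ permProb θ n σ := by
  refine mul_nonneg (by positivity) (Finset.prod_nonneg fun k hk => pow_nonneg (h0 k ?_) _)
  exact (Finset.mem_Icc.1 hk).1

/-- The probability of an event that depends on the cycle type only, in terms of the tilted
rates. -/
lemma permMeasure_apply {θ : ℕ → ℝ} (h0 : ∀ k : ℕ, 1 ≤ k → 0 ≤ θ k) {n : ℕ} (hn : 0 < normConst θ n)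
    (v : ℝ) (P : Multiset ℕ → Prop) [DecidablePred P] :
    permMeasure θ n {σ | P (permPartition σ).parts} =
      ENNReal.ofReal ((∑ p : n.Partition, if P p.parts then partsTerm
        (cycleRate θ v) p.parts else 0) /
        partsSum (Finset.Icc 1 n) (cycleRate θ v) n) := by
  classical
  have h := sum_perm_weight θ n fun m => if P m then 1 else 0
  have hfac : (n.factorial : ℝ) ≠ 0 := by exact_mod_cast n.factorial_ne_zero
  have hr : Real.exp (-v) ^ n ≠ 0 := (pow_pos (Real.exp_pos _) n).ne'
  rw [permMeasure, Measure.finsetSum_apply]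
  have h1 : ∀ σ : Equiv.Perm (Fin n), (ENNReal.ofReal (permProb θ n σ) • Measure.dirac σ)
      {σ | P (permPartition σ).parts} =
      ENNReal.ofReal ((if P (permPartition σ).parts then 1 else 0) * permProb θ n σ) := by
    intro σ
    rw [Measure.smul_apply, Measure.dirac_apply' _ (MeasurableSpace.measurableSet_top), smul_eq_mul]
    by_cases hP : P (permPartition σ).parts <;> simp [hP]
  rw [Finset.sum_congr rfl fun σ _ => h1 σ, ← ENNReal.ofReal_sum_of_nonneg]
  · congr 1
    have h2 : ∀ σ : Equiv.Perm (Fin n), (if P (permPartition σ).parts then (1 : ℝ) else 0) *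
        permProb θ n σ =
        1 / (normConst θ n * n.factorial) *
          ((if P (permPartition σ).parts then 1 else 0) * weight θ n σ) := by
      intro σ
      rw [permProb]
      ring
    rw [Finset.sum_congr rfl fun σ _ => h2 σ, ← Finset.mul_sum, h, ← exp_mul_normConst]
    have h3 : ∀ p : n.Partition, (if P p.parts then partsTerm (cycleRate θ v) p.parts else 0) =
        Real.exp (-v) ^ n * ((if P p.parts then 1 else 0) * partsTerm
          (fun k => θ k / k) p.parts) := by
      intro p
      split_ifs
      · rw [one_mul]
        exact partsTerm_scale _ _ p
      · simp
    rw [Finset.sum_congr rfl fun p _ => h3 p, ← Finset.mul_sum]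
    field_simp
  · intro σ _
    have := permProb_nonneg h0 hn σ
    split_ifs <;> simp [this]

lemma isProbabilityMeasure_permMeasure {θ : ℕ → ℝ} (h0 : ∀ k : ℕ, 1 ≤ k → 0 ≤ θ k) {n : ℕ}
    (hn : 0 < normConst θ n) : IsProbabilityMeasure (permMeasure θ n) := by
  constructor
  have h := permMeasure_apply h0 hn 0 fun _ => True
  simp only [if_true] at h
  rw [← partsSum_Icc, div_self, ENNReal.ofReal_one] at h
  · exact h
  · rw [← exp_mul_normConst]
    have := Real.exp_pos (-0)
    positivity

/-- A lower bound for the probability that the longest cycles have the lengths `m`: the remaining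
cycles may have any lengths below `b ≤ min m`. -/
lemma le_permMeasure_longestCycle {θ : ℕ → ℝ} (h0 : ∀ k : ℕ, 1 ≤ k → 0 ≤ θ k) {n N K b : ℕ}
    (hn : 0 < normConst θ n) (v : ℝ) {m : Fin K → ℕ} (hm : StrictAnti m) (hb : 1 ≤ b)
    (hbm : ∀ i, b ≤ m i) (hN : N + ∑ i, m i = n) :
    ENNReal.ofReal ((∏ i, cycleRate θ v (m i)) * partsSum (Finset.Ico 1 b) (cycleRate θ v) N /
      partsSum (Finset.Icc 1 n) (cycleRate θ v) n) ≤
    permMeasure θ n {σ | ∀ i : Fin K, longestCycle (i + 1) σ = m i} := by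
  classical
  set a := cycleRate θ v with ha
  have hpos : 0 < partsSum (Finset.Icc 1 n) a n := by
    rw [ha, ← exp_mul_normConst]
    have := Real.exp_pos (-v)
    positivity
  refine le_trans ?_ (permMeasure_apply h0 hn v fun q : Multiset ℕ =>
    ∀ i : Fin K, (q.sort (fun a b => a ≥ b)).getD i 0 = m i).ge
  refine ENNReal.ofReal_le_ofReal (div_le_div_of_nonneg_right ?_ hpos.le)
  rw [← Finset.sum_filter, partsSum, Finset.mul_sum]
  set l := List.ofFn m with hl
  have hlmem : ∀ x ∈ l, b ≤ x := by
    intro x hx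
    obtain ⟨i, rfl⟩ := (List.mem_ofFn' m x).1 hx
    exact hbm i
  have hlsum : (l : Multiset ℕ).sum = ∑ i, m i := by simp [hl, List.sum_ofFn]
  have hlnd : l.Nodup := List.nodup_ofFn.2 hm.injective
  have hlp : l.Pairwise (fun a b => a ≥ b) := by
    rw [hl, List.pairwise_ofFn]
    exact fun i j hij => (hm hij).le
  have hlprod : (l.map a).prod = ∏ i, a (m i) := by simp [hl, List.prod_ofFn]
  -- Adding the parts `m` to a partition of `N` into parts below `b` is injective, and the new parts
  -- are the largest ones.
  let f : N.Partition → n.Partition := fun q =>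
    ⟨(l : Multiset ℕ) + q.parts, fun {k} hk => by
      rcases Multiset.mem_add.1 hk with h | h
      · exact hb.trans (hlmem k (by simpa using h))
      · exact q.parts_pos h, by rw [Multiset.sum_add, hlsum, q.parts_sum, ← hN, add_comm]⟩
  have hfinj : Function.Injective f := by
    intro p q h
    have := congrArg Nat.Partition.parts h
    exact Nat.Partition.ext (add_left_cancel this)
  have hqlt : ∀ q : N.Partition, (∀ k ∈ q.parts, k ∈ Finset.Ico 1 b) → ∀ x ∈ l, ∀ y ∈ q.parts,
      y < x :=
    fun q hq x hx y hy => lt_of_lt_of_le (Finset.mem_Ico.1 (hq y hy)).2 (hlmem x hx)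
  calc ∑ q : N.Partition with ∀ k ∈ q.parts, k ∈ Finset.Ico 1 b,
    (∏ i, a (m i)) * partsTerm a q.parts
      = ∑ q : N.Partition with ∀ k ∈ q.parts, k ∈ Finset.Ico 1 b, partsTerm a (f q).parts := by
        refine Finset.sum_congr rfl fun q hq => ?_
        have hq := (Finset.mem_filter.1 hq).2
        rw [← hlprod]
        exact (partsTerm_coe_add a hlnd fun x hx hxq => (hqlt q hq x hx x hxq).false).symm
    _ = ∑ p ∈ (Finset.univ.filter fun q : N.Partition => ∀ k ∈ q.parts, k ∈ Finset.Ico 1 b).image f,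
          partsTerm a p.parts := (Finset.sum_image
            (f := fun p => partsTerm a p.parts) hfinj.injOn).symm
    _ ≤ _ := by
        refine Finset.sum_le_sum_of_subset_of_nonneg ?_ fun p _ _ =>
          partsTerm_nonneg fun k _ => cycleRate_nonneg h0 v k
        intro p hp
        obtain ⟨q, hq, rfl⟩ := Finset.mem_image.1 hp
        have hq := (Finset.mem_filter.1 hq).2
        refine Finset.mem_filter.2 ⟨Finset.mem_univ _, fun i => ?_⟩
        change (((l : Multiset ℕ) + q.parts).sort (fun a b => a ≥ b)).getD i 0 = m i
        rw [sort_coe_add hlp fun x hx y hy => (hqlt q hq x hx y hy).le, List.getD_append _ _ _ _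
          (by simp [hl])]
        simp [hl]

/-! ### Cycle rates near the extremal level -/

lemma tendsto_exp_sub_one_div : Tendsto (fun x : ℝ => (Real.exp x - 1) / x) (𝓝[≠] 0) (𝓝 1) := by
  have h := (Real.hasDerivAt_exp 0).tendsto_slope_zero
  simp only [zero_add, Real.exp_zero, smul_eq_mul] at h
  exact h.congr fun x => by rw [div_eq_inv_mul]

section Level

variable {α : ℝ} {v : ℕ → ℝ}

lemma tendsto_mul_log_inv (hα : 0 < α) (hv : Tendsto v atTop (𝓝[>] 0)) :
    Tendsto (fun n => α * Real.log (v n)⁻¹) atTop atTop :=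
  (Real.tendsto_log_atTop.comp (tendsto_inv_nhdsGT_zero.comp hv)).const_mul_atTop hα

lemma tendsto_ell_div (hα : 0 < α) (hv : Tendsto v atTop (𝓝[>] 0)) :
    Tendsto (fun n => ell α (v n)⁻¹ / (α * Real.log (v n)⁻¹)) atTop (𝓝 1) := by
  have hy := tendsto_mul_log_inv hα hv
  have h1 := (Real.isLittleO_log_id_atTop.tendsto_div_nhds_zero.comp hy).const_mul (α - 1)
  have h2 := h1.const_add 1
  rw [mul_zero, add_zero] at h2
  refine h2.congr' ?_
  filter_upwards [hy.eventually_gt_atTop 0] with n hn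
  simp only [Function.comp, id]
  rw [ell]
  generalize α * Real.log (v n)⁻¹ = L at hn
  field_simp

variable {m : ℕ → ℕ} {y : ℝ}

/-- A length at bounded rescaled distance from the level satisfies `v m ~ α log (1 / v)`. -/
lemma tendsto_mul_div_log (hα : 0 < α) (hv : Tendsto v atTop (𝓝[>] 0))
    (hm : Tendsto (fun n => v n * m n - ell α (v n)⁻¹) atTop (𝓝 y)) :
    Tendsto (fun n => v n * m n / (α * Real.log (v n)⁻¹)) atTop (𝓝 1) := by
  have h := (hm.div_atTop (tendsto_mul_log_inv hα hv)).add (tendsto_ell_div hα hv)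
  rw [zero_add] at h
  refine h.congr fun n => ?_
  rw [← add_div, sub_add_cancel]

lemma tendsto_mul_level_atTop (hα : 0 < α) (hv : Tendsto v atTop (𝓝[>] 0))
    (hm : Tendsto (fun n => v n * m n - ell α (v n)⁻¹) atTop (𝓝 y)) :
    Tendsto (fun n => v n * m n) atTop atTop := by
  have hy := tendsto_mul_log_inv hα hv
  refine ((tendsto_mul_div_log hα hv hm).pos_mul_atTop one_pos hy).congr' ?_
  filter_upwards [hy.eventually_gt_atTop 0] with n hn
  exact div_mul_cancel₀ _ hn.ne'

lemma tendsto_level_atTop (hα : 0 < α) (hv : Tendsto v atTop (𝓝[>] 0))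
    (hm : Tendsto (fun n => v n * m n - ell α (v n)⁻¹) atTop (𝓝 y)) :
    Tendsto m atTop atTop := by
  have hv' : Tendsto v atTop (𝓝 0) := hv.mono_right nhdsWithin_le_nhds
  refine tendsto_natCast_atTop_iff (R := ℝ) |>.1 ?_
  refine tendsto_atTop_mono' _ ?_ (tendsto_mul_level_atTop hα hv hm)
  filter_upwards [hv'.eventually_le_const one_pos] with n h1
  exact mul_le_of_le_one_left (Nat.cast_nonneg _) h1

lemma eventually_level_ge (hα : 0 < α) (hv : Tendsto v atTop (𝓝[>] 0))
    (hm : Tendsto (fun n => v n * m n - ell α (v n)⁻¹) atTop (𝓝 y)) :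
    ∀ᶠ n in atTop, 3 / 4 * α * Real.log (v n)⁻¹ ≤ v n * m n := by
  filter_upwards [(tendsto_mul_log_inv hα hv).eventually_gt_atTop 0,
    (tendsto_mul_div_log hα hv hm).eventually_const_le
      (show (3 / 4 : ℝ) < 1 by norm_num)] with n h1 h2
  rw [le_div_iff₀ h1] at h2
  linarith

lemma tendsto_rpow_mul_level (hα : 0 < α) (hv : Tendsto v atTop (𝓝[>] 0))
    (hm : Tendsto (fun n => v n * m n - ell α (v n)⁻¹) atTop (𝓝 y)) :
    Tendsto (fun n => v n ^ (α / 2) * (v n * m n)) atTop (𝓝 0) := by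
  have hv0 : ∀ᶠ n in atTop, 0 < v n := hv.eventually self_mem_nhdsWithin
  have hinv : Tendsto (fun n => (v n)⁻¹) atTop atTop := tendsto_inv_nhdsGT_zero.comp hv
  have h1 := ((isLittleO_log_rpow_atTop (half_pos hα)).tendsto_div_nhds_zero.comp hinv).mul
    (tendsto_mul_div_log hα hv hm)
  have h2 := h1.const_mul α
  rw [zero_mul, mul_zero] at h2
  refine h2.congr' ?_
  filter_upwards [hv0, (tendsto_mul_log_inv hα hv).eventually_gt_atTop 0] with n hn hL
  have hL' : 0 < Real.log (v n)⁻¹ := pos_of_mul_pos_right hL hα.le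
  simp only [Function.comp]
  rw [Real.inv_rpow hn.le, div_inv_eq_mul]
  generalize Real.log (v n)⁻¹ = L at hL'
  field_simp

/-- The reason for the form of `ell`: it makes `v ^ (-α) (v m) ^ (α - 1) e^{-v m}` of order one when
`v m ~ α log (1 / v)`. -/
lemma exp_ell {w : ℝ} (hw : 0 < w) (hL : 0 < α * Real.log w⁻¹) :
    Real.exp (ell α w⁻¹) = w ^ (-α) * (α * Real.log w⁻¹) ^ (α - 1) := by
  rw [ell, Real.exp_add, Real.rpow_def_of_pos hw, Real.rpow_def_of_pos hL, Real.log_inv]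
  ring_nf

/-- The length of the cell `[exp (ℓ - k w), exp (ℓ - (k - 1) w))` of points that
`cellIndex α w` sends to `k`, where `ℓ = ell α w⁻¹`. -/
noncomputable def cellWidth (α w : ℝ) (k : ℤ) : ℝ :=
  Real.exp (ell α w⁻¹ - k * w) * (Real.exp w - 1)

lemma cellWidth_pos {w : ℝ} (hw : 0 < w) (k : ℤ) : 0 < cellWidth α w k :=
  mul_pos (Real.exp_pos _) (sub_pos.2 (Real.one_lt_exp_iff.2 hw))

variable {θ : ℕ → ℝ}

/-- Near the extremal level, the rate of cycles of length `m` is asymptotic to the length of the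
cell of `m`. -/
lemma tendsto_cycleRate_div_cellWidth (hα : 0 < α) (hθ : θ ~[atTop] fun k : ℕ => (k : ℝ) ^ α)
    (hv : Tendsto v atTop (𝓝[>] 0))
    (hm : Tendsto (fun n => v n * m n - ell α (v n)⁻¹) atTop (𝓝 y)) :
    Tendsto (fun n => cycleRate θ (v n) (m n) / cellWidth α (v n) (m n)) atTop (𝓝 1) := by
  have hv0 : ∀ᶠ n in atTop, 0 < v n := hv.eventually self_mem_nhdsWithin
  have hratio : Tendsto (fun k : ℕ => θ k / (k : ℝ) ^ α) atTop (𝓝 1) := by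
    refine (Asymptotics.isEquivalent_iff_tendsto_one ?_).1 hθ
    filter_upwards [eventually_ge_atTop 1] with k hk
    exact (Real.rpow_pos_of_pos (by exact_mod_cast hk) α).ne'
  have hmt := tendsto_level_atTop hα hv hm
  have h2 : Tendsto (fun n => (v n * m n / (α * Real.log (v n)⁻¹)) ^ (α - 1)) atTop
      (𝓝 (1 ^ (α - 1))) :=
    (tendsto_mul_div_log hα hv hm).rpow_const (Or.inl one_ne_zero)
  have h3 := (tendsto_exp_sub_one_div.comp (hv.mono_right (nhdsGT_le_nhdsNE 0))).inv₀ one_ne_zero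
  have h4 := ((hratio.comp hmt).mul h2).mul h3
  rw [Real.one_rpow, inv_one, mul_one, mul_one] at h4
  refine h4.congr' ?_
  filter_upwards [hv0, (tendsto_mul_log_inv hα hv).eventually_gt_atTop 0, hmt.eventually_ge_atTop 1]
    with n hn hL hm1
  have hm0 : (0 : ℝ) < m n := by exact_mod_cast hm1
  have he : 0 < Real.exp (v n) - 1 := sub_pos.2 (Real.one_lt_exp_iff.2 hn)
  simp only [Function.comp]
  rw [cycleRate, cellWidth, Real.exp_sub, exp_ell hn hL, ← Real.exp_nat_mul, mul_neg, Real.exp_neg,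
    Real.div_rpow (by positivity) hL.le, Real.mul_rpow hn.le hm0.le, Real.rpow_sub_one hm0.ne',
    Real.rpow_sub_one hn.ne', Real.rpow_neg hn.le, Int.cast_natCast]
  have := (Real.rpow_pos_of_pos hn α).ne'
  have := (Real.rpow_pos_of_pos hm0 α).ne'
  have := (Real.rpow_pos_of_pos hL (α - 1)).ne'
  have := (Real.exp_pos (m n * v n)).ne'
  generalize α * Real.log (v n)⁻¹ = L at *
  field_simp

/-- The total rate of cycles of length at least `m`, where `v m - ell → y`,
  is asymptotically at most
`e^{-y}`; the bound is uniform in the upper end of the sum. -/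
lemma eventually_sum_cycleRate_le (hα : 0 < α) (hθ : θ ~[atTop] fun k : ℕ => (k : ℝ) ^ α)
    (hv : Tendsto v atTop (𝓝[>] 0))
    (hm : Tendsto (fun n => v n * m n - ell α (v n)⁻¹) atTop (𝓝 y)) {s : ℝ}
      (hs : Real.exp (-y) < s) :
    ∀ᶠ n in atTop, ∀ B : ℕ, ∑ k ∈ Finset.Ico (m n) B, cycleRate θ (v n) k ≤ s := by
  have hv0 : ∀ᶠ n in atTop, 0 < v n := hv.eventually self_mem_nhdsWithin
  have hv' : Tendsto v atTop (𝓝 0) := hv.mono_right nhdsWithin_le_nhds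
  have hmt := tendsto_level_atTop hα hv hm
  have hvm := tendsto_mul_level_atTop hα hv hm
  obtain ⟨c, hc⟩ : ∃ c, c = |α - 1| := ⟨_, rfl⟩
  have hc0 : 0 ≤ c := hc ▸ abs_nonneg _
  -- The exponential rate of the dominating geometric series.
  obtain ⟨x, hx⟩ : ∃ x : ℕ → ℝ, x = fun n => v n - c / m n := ⟨_, rfl⟩
  have hxv : Tendsto (fun n => x n / v n) atTop (𝓝 1) := by
    have h1 := (tendsto_const_nhds (x := c)).div_atTop hvm
    have h2 := h1.const_sub 1
    rw [sub_zero] at h2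
    refine h2.congr' ?_
    filter_upwards [hv0, hmt.eventually_ge_atTop 1] with n hn hm1
    have hm0 : (0 : ℝ) < m n := by exact_mod_cast hm1
    rw [hx]
    field_simp
  have hx0 : ∀ᶠ n in atTop, 0 < x n := by
    filter_upwards [hv0, hxv.eventually_const_lt one_pos] with n hn h
    exact (div_pos_iff_of_pos_right hn).1 h
  have hxt : Tendsto x atTop (𝓝 0) := by
    have h := hxv.mul hv'
    rw [mul_zero] at h
    refine h.congr' ?_
    filter_upwards [hv0] with n hn using div_mul_cancel₀ _ hn.ne'
  have hgeom : Tendsto (fun n => v n / (1 - Real.exp (-x n))) atTop (𝓝 1) := by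
    have hneg : Tendsto (fun n => -x n) atTop (𝓝[≠] 0) := by
      refine tendsto_nhdsWithin_iff.2 ⟨by simpa using hxt.neg, ?_⟩
      filter_upwards [hx0] with n hn
      exact neg_ne_zero.2 hn.ne'
    have h1 := ((tendsto_exp_sub_one_div.comp hneg).mul hxv).inv₀ (by norm_num)
    rw [mul_one, inv_one] at h1
    refine h1.congr' ?_
    filter_upwards [hv0, hx0] with n hn hxn
    have : Real.exp (-x n) - 1 ≠ 0 := (sub_neg.2 (Real.exp_lt_one_iff.2 (by linarith))).ne
    have h2 : 1 - Real.exp (-x n) ≠ 0 := by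
      intro h; apply this; linarith
    simp only [Function.comp]
    field_simp
    ring
  have h2 : Tendsto (fun n => (v n * m n / (α * Real.log (v n)⁻¹)) ^ (α - 1)) atTop
      (𝓝 (1 ^ (α - 1))) :=
    (tendsto_mul_div_log hα hv hm).rpow_const (Or.inl one_ne_zero)
  have hU := (h2.mul ((Real.continuous_exp.tendsto _).comp hm.neg)).mul hgeom
  rw [Real.one_rpow, one_mul, mul_one] at hU
  obtain ⟨δ, hδ, hδs⟩ : ∃ δ : ℝ, 1 < δ ∧ δ * Real.exp (-y) < s := by
    have h1 : Tendsto (fun δ : ℝ => δ * Real.exp (-y)) (𝓝[>] 1) (𝓝 (1 * Real.exp (-y))) :=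
      (tendsto_id.mono_right nhdsWithin_le_nhds).mul_const _
    rw [one_mul] at h1
    obtain ⟨δ, h, h'⟩ := ((h1.eventually_lt_const hs).and self_mem_nhdsWithin).exists
    exact ⟨δ, h', h⟩
  have hθδ : ∀ᶠ k : ℕ in atTop, θ k ≤ δ * (k : ℝ) ^ α := by
    have hratio : Tendsto (fun k : ℕ => θ k / (k : ℝ) ^ α) atTop (𝓝 1) := by
      refine (Asymptotics.isEquivalent_iff_tendsto_one ?_).1 hθ
      filter_upwards [eventually_ge_atTop 1] with k hk
      exact (Real.rpow_pos_of_pos (by exact_mod_cast hk) α).ne'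
    filter_upwards [hratio.eventually_le_const hδ, eventually_ge_atTop 1] with k hk hk1
    exact (div_le_iff₀ (Real.rpow_pos_of_pos (by exact_mod_cast hk1) α)).1 hk
  obtain ⟨k₀, hk₀⟩ := eventually_atTop.1 hθδ
  filter_upwards [hv0, hx0, (tendsto_mul_log_inv hα hv).eventually_gt_atTop 0,
    hmt.eventually_ge_atTop (max 1 k₀),
      (hU.const_mul δ).eventually_le_const hδs] with n hn hxn hL hmn hUn B
  have hm1 : 1 ≤ m n := (le_max_left _ _).trans hmn
  have hm0 : (0 : ℝ) < m n := by exact_mod_cast hm1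
  have hρ1 : Real.exp (-x n) < 1 := Real.exp_lt_one_iff.2 (by linarith)
  have hterm : ∀ k ∈ Finset.Ico (m n) B, cycleRate θ (v n) k ≤
      δ * ((m n : ℝ) ^ (α - 1) * Real.exp (-(m n * v n))) * Real.exp (-x n) ^ (k - m n) := by
    intro k hk
    have hkm := (Finset.mem_Ico.1 hk).1
    have hkm' : (m n : ℝ) ≤ k := by exact_mod_cast hkm
    have hk0 : (0 : ℝ) < k := hm0.trans_le hkm'
    have hθk := hk₀ k ((le_max_right _ _).trans (hmn.trans hkm))
    have hq1 : 1 ≤ (k : ℝ) / m n := (one_le_div hm0).2 hkm'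
    -- `k / m ≤ exp ((k - m) / m)` turns the power of `k` into a geometric factor.
    have hpow : ((k : ℝ) / m n) ^ (α - 1) ≤ Real.exp (c * (((k : ℝ) - m n) / m n)) := by
      calc ((k : ℝ) / m n) ^ (α - 1) ≤ ((k : ℝ) / m n) ^ c :=
            Real.rpow_le_rpow_of_exponent_le hq1 (hc ▸ le_abs_self _)
        _ ≤ (Real.exp (((k : ℝ) - m n) / m n)) ^ c := by
            refine Real.rpow_le_rpow (by positivity) ?_ hc0
            have := Real.add_one_le_exp (((k : ℝ) - m n) / m n)
            rw [sub_div, div_self hm0.ne', sub_add_cancel] at this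
            rwa [sub_div, div_self hm0.ne']
        _ = _ := by rw [← Real.exp_mul, mul_comm]
    have hkα : (k : ℝ) ^ (α - 1) ≤
        (m n : ℝ) ^ (α - 1) * Real.exp (c * (((k : ℝ) - m n) / m n)) := by
      rw [Real.div_rpow hk0.le hm0.le, div_le_iff₀ (Real.rpow_pos_of_pos hm0 _)] at hpow
      linarith
    calc cycleRate θ (v n) k = θ k / k * Real.exp (-(k * v n)) := by
          rw [cycleRate, ← Real.exp_nat_mul, mul_neg]
      _ ≤ δ * (k : ℝ) ^ α / k * Real.exp (-(k * v n)) := by gcongr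
      _ = δ * (k : ℝ) ^ (α - 1) * Real.exp (-(k * v n)) := by
          rw [Real.rpow_sub_one hk0.ne', mul_div_assoc]
      _ ≤ δ * ((m n : ℝ) ^ (α - 1) * Real.exp (c * (((k : ℝ) - m n) / m n))) * Real.exp
        (-(k * v n)) := by
          gcongr
      _ = _ := by
          rw [← Real.exp_nat_mul, Nat.cast_sub hkm]
          have : Real.exp (c * (((k : ℝ) - m n) / m n)) * Real.exp (-(k * v n)) =
              Real.exp (-(m n * v n)) * Real.exp (((k : ℝ) - m n) * -x n) := by
            rw [← Real.exp_add, ← Real.exp_add, hx]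
            congr 1
            field_simp
            ring
          linear_combination δ * (m n : ℝ) ^ (α - 1) * this
  -- The geometric series with ratio `e^{-x} < 1`.
  have hgs : ∑ k ∈ Finset.Ico (m n) B, Real.exp (-x n) ^ (k - m n) ≤ (1 - Real.exp (-x n))⁻¹ := by
    rw [Finset.sum_Ico_eq_sum_range]
    simp only [add_tsub_cancel_left]
    rw [← tsum_geometric_of_lt_one (Real.exp_pos _).le hρ1]
    exact (summable_geometric_of_lt_one (Real.exp_pos _).le hρ1).sum_le_tsum _
      fun i _ => pow_nonneg (Real.exp_pos _).le i
  refine (Finset.sum_le_sum hterm).trans ?_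
  rw [← Finset.mul_sum]
  refine (mul_le_mul_of_nonneg_left hgs (by positivity)).trans (le_trans (le_of_eq ?_) hUn)
  simp only [Function.comp]
  have h1ρ : 1 - Real.exp (-x n) ≠ 0 := (sub_pos.2 hρ1).ne'
  rw [neg_sub, Real.exp_sub, exp_ell hn hL, Real.exp_neg,
    Real.div_rpow (by positivity) hL.le, Real.mul_rpow hn.le hm0.le, Real.rpow_sub_one hn.ne',
    Real.rpow_neg hn.le, mul_comm (m n : ℝ) (v n)]
  have := (Real.rpow_pos_of_pos hn α).ne'
  have := (Real.rpow_pos_of_pos hL (α - 1)).ne'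
  have := (Real.exp_pos (v n * m n)).ne'
  generalize α * Real.log (v n)⁻¹ = L at *
  field_simp

end Level

/-! ### The local law of the longest cycles -/

section Pattern

variable {α : ℝ} {θ : ℕ → ℝ} {v : ℕ → ℝ}

lemma tendsto_rpow_mul_saddle (hα : 0 < α) (h0 : ∀ k : ℕ, 1 ≤ k → 0 ≤ θ k)
    (hθ : θ ~[atTop] fun k : ℕ => (k : ℝ) ^ α) (hv : ∀ n : ℕ, 1 ≤ n → IsSaddlePoint θ n (v n)) :
    Tendsto (fun n : ℕ => v n ^ (α + 1) * n) atTop (𝓝 (Real.Gamma (α + 1))) := by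
  refine ((tendsto_expSeries hα.le hθ).comp (tendsto_saddlePoint hα.le h0 hθ hv)).congr' ?_
  filter_upwards [eventually_ge_atTop 1] with n hn
  simp only [Function.comp]
  rw [((isSaddlePoint_iff hα.le hθ _ _).1 (hv n hn)).2]

/-- The hypothesis of the local limit theorem when no cycle length is excluded. -/
lemma eventually_saddle_ge (hα : 0 < α) (h0 : ∀ k : ℕ, 1 ≤ k → 0 ≤ θ k)
    (hθ : θ ~[atTop] fun k : ℕ => (k : ℝ) ^ α) (hv : ∀ n : ℕ, 1 ≤ n → IsSaddlePoint θ n (v n)) :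
    ∀ᶠ n in atTop, 3 / 4 * α * Real.log (v n)⁻¹ ≤ v n * ((n + 1 : ℕ) : ℝ) := by
  have hvt := tendsto_saddlePoint hα.le h0 hθ hv
  have hG : 0 < Real.Gamma (α + 1) := Real.Gamma_pos_of_pos (by linarith)
  have hinv : Tendsto (fun n => (v n)⁻¹) atTop atTop := tendsto_inv_nhdsGT_zero.comp hvt
  have h1 := ((isLittleO_log_rpow_atTop hα).tendsto_div_nhds_zero.comp hinv).const_mul (3 / 4 * α)
  rw [mul_zero] at h1
  have h2 := h1.eventually_lt (tendsto_rpow_mul_saddle hα h0 hθ hv) hG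
  filter_upwards [h2, hvt.eventually self_mem_nhdsWithin] with n hn (hvn : 0 < v n)
  simp only [Function.comp] at hn
  rw [Real.inv_rpow hvn.le, div_inv_eq_mul, Real.rpow_add_one hvn.ne'] at hn
  have hp : 0 < v n ^ α := Real.rpow_pos_of_pos hvn α
  have h3 : 3 / 4 * α * Real.log (v n)⁻¹ < v n * n := by
    refine lt_of_mul_lt_mul_left (a := v n ^ α) ?_ hp.le
    linarith
  push_cast
  linarith

lemma tendsto_partsSum_saddle (hα : 0 < α) (h0 : ∀ k : ℕ, 1 ≤ k → 0 ≤ θ k)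
    (hθ : θ ~[atTop] fun k : ℕ => (k : ℝ) ^ α) (hv : ∀ n : ℕ, 1 ≤ n → IsSaddlePoint θ n (v n)) :
    Tendsto (fun n => v n ^ (-(1 + α / 2)) *
      (Real.exp (-∑ k ∈ Finset.Ico 1 (n + 1), cycleRate θ (v n) k) *
      partsSum (Finset.Ico 1 (n + 1)) (cycleRate θ (v n)) n)) atTop (𝓝 (gaussConst α)) := by
  refine tendsto_partsSum_cycleRate hα h0 hθ (tendsto_saddlePoint hα.le h0 hθ hv)
    (b := fun n => n + 1)
    (eventually_saddle_ge hα h0 hθ hv) (N := fun n => n) ?_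
  refine tendsto_const_nhds.congr' ?_
  filter_upwards [eventually_ge_atTop 1] with n hn
  rw [((isSaddlePoint_iff hα.le hθ _ _).1 (hv n hn)).2, sub_self, mul_zero]

lemma eventually_normConst_pos (hα : 0 < α) (h0 : ∀ k : ℕ, 1 ≤ k → 0 ≤ θ k)
    (hθ : θ ~[atTop] fun k : ℕ => (k : ℝ) ^ α) (hv : ∀ n : ℕ, 1 ≤ n → IsSaddlePoint θ n (v n)) :
    ∀ᶠ n in atTop, 0 < normConst θ n := by
  have hvt := tendsto_saddlePoint hα.le h0 hθ hv
  filter_upwards [(tendsto_partsSum_saddle hα h0 hθ hv).eventually_const_lt (gaussConst_pos hα),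
    hvt.eventually self_mem_nhdsWithin] with n hn (hvn : 0 < v n)
  have h1 := pos_of_mul_pos_right (pos_of_mul_pos_right hn (Real.rpow_nonneg hvn.le _))
      (Real.exp_pos _).le
  have h2 : Finset.Ico 1 (n + 1) = Finset.Icc 1 n := by ext; simp
  rw [h2, ← exp_mul_normConst] at h1
  exact pos_of_mul_pos_right h1 (pow_pos (Real.exp_pos _) n).le

/-- The arithmetic that recombines the limits of the factors `R / W`, `τ x P / (τ z Q)` and `t`. -/
lemma mul_le_of_lt_ratio {r R W P Q x z t τ : ℝ} (hW : 0 < W) (hQ : 0 < Q) (hR : 0 ≤ R) (hP : 0 ≤ P)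
    (hτ : 0 < τ) (hz : 0 < z) (htx : t * x ≤ z)
    (h : r < R / W * (τ * (x * P) / (τ * (z * Q))) * t) : r * W ≤ R * P / Q := by
  calc r * W ≤ R / W * (τ * (x * P) / (τ * (z * Q))) * t * W :=
    mul_le_mul_of_nonneg_right h.le hW.le
    _ = R * P / Q * (t * x / z) := by field_simp
    _ ≤ R * P / Q := mul_le_of_le_one_right (by positivity) ((div_le_one hz).2 htx)

/-- The local law of the longest cycles: if `v m_i - ell → y_i` with `y_1 > y_2 > ⋯`, then the
probability that the longest cycles have lengths `m_1, m_2, …` is asymptotically at least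
`exp (-e^{-y_K})` times the volume of the cell of `m`, for vectors of `K` lengths. -/
theorem eventually_le_permMeasure (hα : 0 < α) (h0 : ∀ k : ℕ, 1 ≤ k → 0 ≤ θ k)
    (hθ : θ ~[atTop] fun k : ℕ => (k : ℝ) ^ α) (hv : ∀ n : ℕ, 1 ≤ n → IsSaddlePoint θ n (v n))
    {K : ℕ} {y : Fin (K + 1) → ℝ} (hy : StrictAnti y) {m : ℕ → Fin (K + 1) → ℕ}
    (hm : ∀ i, Tendsto (fun n => v n * m n i - ell α (v n)⁻¹) atTop (𝓝 (y i))) {r : ℝ}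
    (hr : r < Real.exp (-Real.exp (-y (Fin.last K)))) :
    ∀ᶠ n in atTop, ENNReal.ofReal (r * ∏ i, cellWidth α (v n) (m n i)) ≤
      permMeasure θ n {σ | ∀ i : Fin (K + 1), longestCycle (i + 1) σ = m n i} := by
  have hvt := tendsto_saddlePoint hα.le h0 hθ hv
  have hv' : Tendsto v atTop (𝓝 0) := hvt.mono_right nhdsWithin_le_nhds
  have hv0 : ∀ᶠ n in atTop, 0 < v n := hvt.eventually self_mem_nhdsWithin
  -- Leave room for the tail of the rates to exceed its limit `exp (-y_K)` slightly.
  obtain ⟨s, hys, hrs⟩ : ∃ s, Real.exp (-y (Fin.last K)) < s ∧ r < Real.exp (-s) := by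
    have h1 : Tendsto (fun s : ℝ => Real.exp (-s)) (𝓝[>] (Real.exp (-y (Fin.last K))))
        (𝓝 (Real.exp (-Real.exp (-y (Fin.last K))))) :=
      ((Real.continuous_exp.comp continuous_neg).tendsto _).mono_left nhdsWithin_le_nhds
    obtain ⟨s, h, h'⟩ := ((h1.eventually_const_lt hr).and self_mem_nhdsWithin).exists
    exact ⟨s, h', h⟩
  -- The cycle lengths are negligible on the scale of the fluctuations.
  have hsum : Tendsto (fun n => v n ^ (1 + α / 2) * ∑ i, (m n i : ℝ)) atTop (𝓝 0) := by
    have h1 := tendsto_finsetSum Finset.univ fun i _ => tendsto_rpow_mul_level hα hvt (hm i)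
    rw [Finset.sum_const_zero] at h1
    refine h1.congr' ?_
    filter_upwards [hv0] with n hn
    rw [← Finset.mul_sum, ← Finset.mul_sum, ← mul_assoc, ← Real.rpow_add_one hn.ne', add_comm]
  have hle : ∀ᶠ n in atTop, ∑ i, m n i ≤ n := by
    have hG : 0 < Real.Gamma (α + 1) := Real.Gamma_pos_of_pos (by linarith)
    have h2 := hv'.rpow_const (p := α / 2) (Or.inr (by positivity))
    rw [Real.zero_rpow (by positivity)] at h2
    have h3 := h2.mul hsum
    rw [zero_mul] at h3
    filter_upwards [hv0, h3.eventually_lt (tendsto_rpow_mul_saddle hα h0 hθ hv) hG] with n hn hlt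
    rw [← mul_assoc, ← Real.rpow_add hn, show α / 2 + (1 + α / 2) = α + 1 by ring] at hlt
    have h4 := lt_of_mul_lt_mul_left hlt (Real.rpow_nonneg hn.le _)
    have h5 : ((∑ i, m n i : ℕ) : ℝ) < n := by push_cast; exact h4
    exact_mod_cast h5.le
  have hanti : ∀ᶠ n in atTop, StrictAnti (m n) := by
    have h1 : ∀ i j : Fin (K + 1), i < j → ∀ᶠ n in atTop, m n j < m n i := by
      intro i j hij
      filter_upwards [hv0, (hm j).eventually_lt (hm i) (hy hij)] with n hn hlt
      have h2 := lt_of_mul_lt_mul_left ((sub_lt_sub_iff_right _).1 hlt) hn.le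
      exact_mod_cast h2
    have h2 : ∀ᶠ n in atTop, ∀ i j : Fin (K + 1), i < j → m n j < m n i := by
      simp_rw [eventually_all]
      exact h1
    exact h2.mono fun n hn i j hij => hn i j hij
  -- The two local probabilities have the same limit: without the long cycles, the size
  -- `n - ∑ m_i` is still close to the mean, and the truncation at `m_K` is harmless.
  have hA : Tendsto (fun n => v n ^ (-(1 + α / 2)) *
      (Real.exp (-∑ k ∈ Finset.Ico 1 (m n (Fin.last K)), cycleRate θ (v n) k) *
      partsSum (Finset.Ico 1 (m n (Fin.last K))) (cycleRate θ (v n)) (n - ∑ i, m n i))) atTop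
      (𝓝 (gaussConst α)) := by
    refine tendsto_partsSum_cycleRate hα h0 hθ hvt (b := fun n => m n (Fin.last K))
      (eventually_level_ge hα hvt (hm _)) (N := fun n => n - ∑ i, m n i) ?_
    refine hsum.congr' ?_
    filter_upwards [eventually_ge_atTop 1, hle] with n hn hlen
    rw [((isSaddlePoint_iff hα.le hθ _ _).1 (hv n hn)).2, Nat.cast_sub hlen]
    push_cast
    ring
  have hB := tendsto_partsSum_saddle hα h0 hθ hv
  have hAB := hA.div hB (gaussConst_pos hα).ne'
  rw [div_self (gaussConst_pos hα).ne'] at hAB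
  have hrate := tendsto_finsetProd Finset.univ fun i _ => tendsto_cycleRate_div_cellWidth hα hθ hvt
      (hm i)
  rw [Finset.prod_const_one] at hrate
  have hlim := (hrate.mul hAB).mul_const (Real.exp (-s))
  rw [one_mul, one_mul] at hlim
  filter_upwards [hv0, hle, hanti, hlim.eventually_const_lt hrs,
    eventually_sum_cycleRate_le hα hθ hvt (hm (Fin.last K)) hys,
      eventually_normConst_pos hα h0 hθ hv,
    (tendsto_level_atTop hα hvt (hm (Fin.last K))).eventually_ge_atTop 1]
    with n hvn hlen han hrn htail hnc hm1
  have hle_last : ∀ i, m n (Fin.last K) ≤ m n i := fun i => han.antitone (Fin.le_last i)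
  have hmn : m n (Fin.last K) ≤ n := by
    refine le_trans ?_ hlen
    exact Finset.single_le_sum (f := fun i => m n i) (fun i _ => Nat.zero_le _) (Finset.mem_univ _)
  refine le_trans (ENNReal.ofReal_le_ofReal ?_)
    (le_permMeasure_longestCycle h0 hnc (v n) han hm1 hle_last (Nat.sub_add_cancel hlen))
  have hIco : Finset.Ico 1 (n + 1) = Finset.Icc 1 n := by ext; simp
  have hQpos : 0 < partsSum (Finset.Icc 1 n) (cycleRate θ (v n)) n := by
    rw [← exp_mul_normConst]
    have := Real.exp_pos (-v n)
    positivity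
  have hsplit : ∑ k ∈ Finset.Icc 1 n, cycleRate θ (v n) k =
      ∑ k ∈ Finset.Ico 1 (m n (Fin.last K)), cycleRate θ (v n) k +
        ∑ k ∈ Finset.Ico (m n (Fin.last K)) (n + 1), cycleRate θ (v n) k := by
    rw [← hIco, Finset.sum_Ico_consecutive _ hm1 (by lia)]
  rw [Finset.prod_div_distrib, Pi.div_apply, hIco] at hrn
  refine mul_le_of_lt_ratio (Finset.prod_pos fun i _ => cellWidth_pos hvn _) hQpos
    (Finset.prod_nonneg fun i _ => cycleRate_nonneg h0 _ _)
    (Finset.sum_nonneg fun p _ => partsTerm_nonneg fun k _ => cycleRate_nonneg h0 _ k)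
    (Real.rpow_pos_of_pos hvn _) (Real.exp_pos _) ?_ hrn
  rw [hsplit, ← Real.exp_add]
  exact Real.exp_le_exp.2 (by linarith [htail (n + 1)])

end Pattern

/-! ### Partial sums of independent exponential variables -/

section LimitLaw

lemma integrable_exponentialPDFReal : Integrable (exponentialPDFReal 1) := by
  refine ⟨(measurable_exponentialPDFReal 1).aestronglyMeasurable, ?_⟩
  rw [hasFiniteIntegral_iff_ofReal
    (Eventually.of_forall fun x => exponentialPDFReal_nonneg one_pos x)]
  have := lintegral_exponentialPDF_eq_one one_pos
  simp only [exponentialPDF] at this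
  rw [this]
  exact ENNReal.one_lt_top

/-- Tonelli's theorem for a product of functions of separate coordinates. -/
lemma lintegral_prod_ofReal {ι : Type*} [Fintype ι] {f : ι → ℝ → ℝ} (hf : ∀ i, Integrable (f i))
    (h0 : ∀ i x, 0 ≤ f i x) :
    ∫⁻ x : ι → ℝ, ∏ i, ENNReal.ofReal (f i (x i)) = ∏ i, ∫⁻ x, ENNReal.ofReal (f i x) := by
  have h1 : ∀ x : ι → ℝ, ∏ i, ENNReal.ofReal (f i (x i)) = ENNReal.ofReal (∏ i, f i (x i)) :=
      fun x =>
    (ENNReal.ofReal_prod_of_nonneg fun i _ => h0 i _).symm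
  simp_rw [h1]
  rw [volume_pi, ← ofReal_integral_eq_lintegral_ofReal (Integrable.fintype_prod hf)
    (Eventually.of_forall fun x => Finset.prod_nonneg fun i _ => h0 i _),
    integral_fintype_prod_eq_prod, ENNReal.ofReal_prod_of_nonneg fun i _ => integral_nonneg (h0 i)]
  exact Finset.prod_congr rfl fun i _ =>
    ofReal_integral_eq_lintegral_ofReal (hf i) (Eventually.of_forall (h0 i))

lemma pi_expMeasure_eq_withDensity (ι : Type*) [Fintype ι] :
    Measure.pi (fun _ : ι => expMeasure 1) =
      (volume : Measure (ι → ℝ)).withDensity fun x => ∏ i, exponentialPDF 1 (x i) := by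
  have := isProbabilityMeasure_expMeasure one_pos
  refine Measure.pi_eq fun s hs => ?_
  rw [withDensity_apply _ (MeasurableSet.univ_pi hs), ← lintegral_indicator
    (MeasurableSet.univ_pi hs)]
  have h1 : ∀ x : ι → ℝ, (Set.univ.pi s).indicator (fun x => ∏ i, exponentialPDF 1 (x i)) x =
      ∏ i, ENNReal.ofReal ((s i).indicator (exponentialPDFReal 1) (x i)) := by
    intro x
    by_cases hx : x ∈ Set.univ.pi s
    · rw [Set.indicator_of_mem hx]
      refine Finset.prod_congr rfl fun i _ => ?_
      rw [Set.indicator_of_mem (hx i (Set.mem_univ i))]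
      rfl
    · rw [Set.indicator_of_notMem hx]
      simp only [Set.mem_univ_pi, not_forall] at hx
      obtain ⟨i, hi⟩ := hx
      refine (Finset.prod_eq_zero (Finset.mem_univ i) ?_).symm
      rw [Set.indicator_of_notMem hi, ENNReal.ofReal_zero]
  simp_rw [h1]
  rw [lintegral_prod_ofReal (fun i => integrable_exponentialPDFReal.indicator (hs i))
    (fun i x => Set.indicator_nonneg (fun x _ => exponentialPDFReal_nonneg one_pos x) x)]
  refine Finset.prod_congr rfl fun i _ => ?_
  rw [expMeasure, gammaMeasure, withDensity_apply _ (hs i), ← lintegral_indicator (hs i)]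
  refine lintegral_congr fun x => ?_
  by_cases hx : x ∈ s i
  · rw [Set.indicator_of_mem hx, Set.indicator_of_mem hx]
    rfl
  · rw [Set.indicator_of_notMem hx, Set.indicator_of_notMem hx, ENNReal.ofReal_zero]

/-- The partial sums `e_1, e_1 + e_2, …`: arrival times in terms of waiting times. -/
def partialSums {K : ℕ} (e : Fin K → ℝ) : Fin K → ℝ := fun i => ∑ j ∈ Finset.Iic i, e j

/-- The matrix of `partialSums` is lower triangular with unit diagonal. -/
lemma measurePreserving_partialSums (K : ℕ) :
    MeasurePreserving (partialSums : (Fin K → ℝ) → Fin K → ℝ) := by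
  obtain ⟨M, hM⟩ : ∃ M : Matrix (Fin K) (Fin K) ℝ, ∀ i j, M i j = if j ≤ i then 1 else 0 :=
    ⟨Matrix.of fun i j => if j ≤ i then 1 else 0, fun _ _ => rfl⟩
  have hdet : M.det = 1 := by
    rw [Matrix.det_of_isLowerTriangular]
    · simp [hM]
    · intro i j hij
      simpa [hM] using hij
  have hT : (Matrix.toLin' M : (Fin K → ℝ) → Fin K → ℝ) = partialSums := by
    ext e i
    simp only [Matrix.toLin'_apply, Matrix.mulVec, dotProduct, hM, partialSums, ite_mul, one_mul,
      zero_mul]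
    rw [← Finset.sum_filter, Finset.filter_ge_eq_Iic]
  have h := Real.map_matrix_volume_pi_eq_smul_volume_pi (M := M) (by rw [hdet]; exact one_ne_zero)
  rw [hdet, hT, inv_one, abs_one, ENNReal.ofReal_one, one_smul] at h
  refine ⟨?_, h⟩
  rw [← hT]
  exact (LinearMap.continuous_on_pi _).measurable

/-- The set `0 < g_1 < ⋯ < g_K`, where arrival times with positive waiting times live. -/
def arrivalChamber (K : ℕ) : Set (Fin K → ℝ) := {g | (∀ i, 0 < g i) ∧ StrictMono g}

lemma measurableSet_arrivalChamber (K : ℕ) : MeasurableSet (arrivalChamber K) := by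
  have h : arrivalChamber K = (⋂ i, {g | 0 < g i}) ∩ ⋂ i, ⋂ j, ⋂ _ : i < j, {g | g i < g j} := by
    ext g
    simp [arrivalChamber, StrictMono]
  rw [h]
  refine (MeasurableSet.iInter fun i => measurableSet_lt measurable_const
    (measurable_pi_apply i)).inter
    (MeasurableSet.iInter fun i => MeasurableSet.iInter fun j => MeasurableSet.iInter fun _ =>
      measurableSet_lt (measurable_pi_apply i) (measurable_pi_apply j))

/-- The partial sums of independent exponential variables have density `e^{-g_K}` on the chamber;
only this half of the equality is needed. -/
lemma pi_expMeasure_partialSums_le {K : ℕ} {B : Set (Fin (K + 1) → ℝ)} (hB : MeasurableSet B) :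
    Measure.pi (fun _ : Fin (K + 1) => expMeasure 1) (partialSums ⁻¹' B) ≤
      ∫⁻ g in B ∩ arrivalChamber (K + 1), ENNReal.ofReal (Real.exp (-g (Fin.last K))) := by
  have hT := measurePreserving_partialSums (K + 1)
  have hBA := hB.inter (measurableSet_arrivalChamber (K + 1))
  rw [pi_expMeasure_eq_withDensity, withDensity_apply _ (hT.measurable hB),
    ← lintegral_indicator (hT.measurable hB), ← lintegral_indicator hBA,
    ← hT.lintegral_comp (f := (B ∩ arrivalChamber (K + 1)).indicator
      fun g => ENNReal.ofReal (Real.exp (-g (Fin.last K))))]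
  -- Points with a zero coordinate are excluded because `exponentialPDF 1 0 = 1`, whereas the
  -- chamber is open.
  · have hne : ∀ᵐ e : Fin (K + 1) → ℝ, ∀ i, e i ≠ 0 := by
      rw [ae_all_iff]
      intro i
      rw [ae_iff, volume_pi]
      simpa using Measure.pi_hyperplane (fun _ : Fin (K + 1) => (volume : Measure ℝ)) i 0
    refine lintegral_mono_ae ?_
    filter_upwards [hne] with e he
    by_cases hTe : e ∈ partialSums ⁻¹' B
    -- For positive waiting times the product of the densities depends on the last partial sum only;
    -- otherwise it vanishes.
    · rw [Set.indicator_of_mem hTe]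
      by_cases hpos : ∀ i, 0 < e i
      · have hA : partialSums e ∈ arrivalChamber (K + 1) := by
          refine ⟨fun i => Finset.sum_pos (fun j _ => hpos j) ⟨i, Finset.mem_Iic.2 le_rfl⟩,
            fun i j hij => ?_⟩
          refine Finset.sum_lt_sum_of_subset (Finset.Iic_subset_Iic.2 hij.le) (i := j)
            (Finset.mem_Iic.2 le_rfl) (by simpa using hij) (hpos j) fun k _ _ => (hpos k).le
        rw [Set.indicator_of_mem (show partialSums e ∈ B ∩ arrivalChamber (K + 1) from ⟨hTe, hA⟩)]
        have hlast : partialSums e (Fin.last K) = ∑ i, e i := by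
          rw [partialSums]
          congr 1
          ext j
          simp [Fin.le_last]
        rw [hlast, ← Finset.sum_neg_distrib, Real.exp_sum, ENNReal.ofReal_prod_of_nonneg
          fun i _ => (Real.exp_pos _).le]
        refine (Finset.prod_congr rfl fun i _ => ?_).le
        rw [exponentialPDF_of_nonneg (hpos i).le]
        simp
      · push Not at hpos
        obtain ⟨i, hi⟩ := hpos
        rw [Finset.prod_eq_zero (Finset.mem_univ i)
          (exponentialPDF_of_neg (lt_of_le_of_ne hi (he i)))]
        exact zero_le
    · rw [Set.indicator_of_notMem hTe]
      exact zero_le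
  · refine Measurable.indicator ?_ hBA
    fun_prop

end LimitLaw

/-! ### From the local law to open sets -/

section Fatou

variable {α : ℝ}

/-- The cycle length represented by the point `g > 0`: the least integer `k` with
`exp (-(k w - ℓ)) ≤ g`, where `ℓ = ell α w⁻¹`.  It is an integer rather than a natural number so
that the cells cover all of `(0, ∞)`. -/
noncomputable def cellIndex (α w g : ℝ) : ℤ := ⌈(ell α w⁻¹ - Real.log g) / w⌉

lemma measurable_cellIndex (α w : ℝ) : Measurable (cellIndex α w) :=
  Int.measurable_ceil.comp ((measurable_const.sub Real.measurable_log).div_const w)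

lemma cellIndex_preimage {w : ℝ} (hw : 0 < w) (k : ℤ) :
    {g | cellIndex α w g = k} ∩ Set.Ioi 0 =
      Set.Ico (Real.exp (ell α w⁻¹ - k * w)) (Real.exp (ell α w⁻¹ - (k - 1) * w)) := by
  ext g
  simp only [Set.mem_inter_iff, Set.mem_ofPred_eq, Set.mem_Ioi, Set.mem_Ico]
  have key : ∀ hg : 0 < g, cellIndex α w g = k ↔
      Real.exp (ell α w⁻¹ - k * w) ≤ g ∧ g < Real.exp (ell α w⁻¹ - (k - 1) * w) := by
    intro hg
    rw [cellIndex, Int.ceil_eq_iff, lt_div_iff₀ hw, div_le_iff₀ hw, ← Real.le_log_iff_exp_le hg,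
      ← Real.log_lt_iff_lt_exp hg]
    constructor <;> rintro ⟨h1, h2⟩ <;> constructor <;> linarith
  constructor
  · rintro ⟨h, hg⟩
    exact (key hg).1 h
  · rintro ⟨h1, h2⟩
    have hg := (Real.exp_pos _).trans_le h1
    exact ⟨(key hg).2 ⟨h1, h2⟩, hg⟩

lemma restrict_cellIndex_preimage {w : ℝ} (hw : 0 < w) (k : ℤ) :
    (volume.restrict (Set.Ioi (0 : ℝ))) {g | cellIndex α w g = k} =
      ENNReal.ofReal (cellWidth α w k) := by
  have hmeas : MeasurableSet {g | cellIndex α w g = k} :=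
    measurable_cellIndex α w (measurableSet_singleton k)
  rw [Measure.restrict_apply hmeas, cellIndex_preimage hw, Real.volume_Ico, cellWidth,
    show ell α w⁻¹ - ((k : ℝ) - 1) * w = (ell α w⁻¹ - k * w) + w by ring, Real.exp_add]
  congr 1
  ring

/-- Lebesgue measure on the open orthant `(0, ∞)^K`, as a product measure on `Fin K → ℝ`. -/
noncomputable def orthantVolume (K : ℕ) : Measure (Fin K → ℝ) :=
  Measure.pi fun _ => volume.restrict (Set.Ioi (0 : ℝ))

lemma measurable_cellIndex_pi (α w : ℝ) (K : ℕ) :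
    Measurable fun (g : Fin K → ℝ) i => cellIndex α w (g i) :=
  measurable_pi_lambda _ fun i => (measurable_cellIndex α w).comp (measurable_pi_apply i)

/-- Integrating a function that is constant on cells. -/
lemma lintegral_cellIndex {w : ℝ} (hw : 0 < w) {K : ℕ} (F : (Fin K → ℤ) → ENNReal) :
    ∫⁻ g, F (fun i => cellIndex α w (g i)) ∂(orthantVolume K) =
      ∑' m, F m * ENNReal.ofReal (∏ i, cellWidth α w (m i)) := by
  rw [← lintegral_map (μ := orthantVolume K) (f := F) (Measurable.of_discrete)
    (measurable_cellIndex_pi α w K), lintegral_countable']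
  refine tsum_congr fun m => ?_
  congr 1
  rw [Measure.map_apply (measurable_cellIndex_pi α w K) (measurableSet_singleton m)]
  have : (fun (g : Fin K → ℝ) i => cellIndex α w (g i)) ⁻¹' {m} =
      Set.univ.pi fun i => {g | cellIndex α w g = m i} := by
    ext g
    simp [funext_iff]
  rw [this, orthantVolume, Measure.pi_pi, ENNReal.ofReal_prod_of_nonneg fun i _ =>
    (cellWidth_pos hw _).le]
  exact Finset.prod_congr rfl fun i _ => restrict_cellIndex_preimage hw (m i)

/-- The probability that the `K` longest cycles have lengths `m`, divided by the volume of the cell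
cell of `m`. -/
noncomputable def cellDensity (θ : ℕ → ℝ) (α w : ℝ) (n K : ℕ) (m : Fin K → ℤ) : ENNReal :=
  permMeasure θ n {σ | ∀ i : Fin K, (longestCycle (i + 1) σ : ℤ) = m i} /
    ENNReal.ofReal (∏ i, cellWidth α w (m i))

/-- The affine map of `rescaledLongest`, with `n* = w⁻¹`, on vectors of integers. -/
noncomputable def rescale (α w : ℝ) {K : ℕ} (m : Fin K → ℤ) : Fin K → ℝ :=
  fun i => (1 / w⁻¹) * (m i - w⁻¹ * ell α w⁻¹)

/-- Spreading the mass of each vector of lengths uniformly over its cell represents the law of the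
rescaled longest cycles by a density on the orthant. -/
lemma permMeasure_rescaledLongest_eq (θ : ℕ → ℝ) {w : ℝ} (hw : 0 < w) (n K : ℕ)
    (G : Set (Fin K → ℝ)) :
    permMeasure θ n {σ | rescaledLongest K α w⁻¹ σ ∈ G} =
      ∫⁻ g, (rescale α w ⁻¹' G).indicator (cellDensity θ α w n K) (fun i => cellIndex α w (g i))
        ∂(orthantVolume K) := by
  rw [lintegral_cellIndex hw]
  set X : Equiv.Perm (Fin n) → Fin K → ℤ := fun σ i => (longestCycle (i + 1) σ : ℤ) with hX
  have hXm : Measurable X := measurable_from_top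
  have h1 : {σ : Equiv.Perm (Fin n) | rescaledLongest K α w⁻¹ σ ∈ G} =
      X ⁻¹' (rescale α w ⁻¹' G) := by
    ext σ
    have : rescaledLongest K α w⁻¹ σ = rescale α w (X σ) := by
      ext i
      simp [rescaledLongest, rescale, hX]
    simp [this]
  rw [h1, ← Measure.map_apply hXm (MeasurableSet.of_discrete),
    ← Measure.tsum_indicator_apply_singleton _ _ (MeasurableSet.of_discrete)]
  refine tsum_congr fun m => ?_
  by_cases hm : m ∈ rescale α w ⁻¹' G
  · rw [Set.indicator_of_mem hm, Set.indicator_of_mem hm, cellDensity,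
      Measure.map_apply hXm (measurableSet_singleton m), ENNReal.div_mul_cancel]
    · congr 1
      ext σ
      simp [hX, funext_iff]
    · exact (ENNReal.ofReal_pos.2 (Finset.prod_pos fun i _ => cellWidth_pos hw _)).ne'
    · exact ENNReal.ofReal_ne_top
  · rw [Set.indicator_of_notMem hm, Set.indicator_of_notMem hm, zero_mul]

variable {θ : ℕ → ℝ} {v : ℕ → ℝ}

lemma tendsto_mul_cellIndex (α : ℝ) (hv : Tendsto v atTop (𝓝[>] 0)) (g : ℝ) :
    Tendsto (fun n => v n * cellIndex α (v n) g - ell α (v n)⁻¹) atTop (𝓝 (-Real.log g)) := by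
  have hv' : Tendsto v atTop (𝓝 0) := hv.mono_right nhdsWithin_le_nhds
  have h2 := hv'.add_const (-Real.log g)
  rw [zero_add] at h2
  refine tendsto_of_tendsto_of_tendsto_of_le_of_le' tendsto_const_nhds h2 ?_ ?_
  · filter_upwards [hv.eventually self_mem_nhdsWithin] with n (hn : 0 < v n)
    have := Int.le_ceil ((ell α (v n)⁻¹ - Real.log g) / v n)
    rw [div_le_iff₀ hn] at this
    rw [cellIndex]
    linarith
  · filter_upwards [hv.eventually self_mem_nhdsWithin] with n (hn : 0 < v n)
    have := (Int.ceil_lt_add_one ((ell α (v n)⁻¹ - Real.log g) / v n)).le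
    have h3 := mul_le_mul_of_nonneg_left this hn.le
    rw [mul_add, mul_div_cancel₀ _ hn.ne', mul_one] at h3
    rw [cellIndex]
    linarith

lemma tendsto_ell_atTop (hα : 0 < α) (hv : Tendsto v atTop (𝓝[>] 0)) :
    Tendsto (fun n => ell α (v n)⁻¹) atTop atTop := by
  have hy := tendsto_mul_log_inv hα hv
  refine ((tendsto_ell_div hα hv).pos_mul_atTop one_pos hy).congr' ?_
  filter_upwards [hy.eventually_gt_atTop 0] with n hn
  exact div_mul_cancel₀ _ hn.ne'

lemma eventually_cellIndex_pos (hα : 0 < α) (hv : Tendsto v atTop (𝓝[>] 0)) (g : ℝ) :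
    ∀ᶠ n in atTop, 0 < cellIndex α (v n) g := by
  filter_upwards [hv.eventually self_mem_nhdsWithin,
    (tendsto_ell_atTop hα hv).eventually_gt_atTop (Real.log g)] with n (hn : 0 < v n) h
  exact Int.ceil_pos.2 (div_pos (by linarith) hn)

/-- The pointwise lower bound for the density.  It holds for points of the chamber only, where the
lengths given by `cellIndex` have distinct limits after rescaling. -/
lemma ofReal_le_liminf_cellDensity (hα : 0 < α) (h0 : ∀ k : ℕ, 1 ≤ k → 0 ≤ θ k)
    (hθ : θ ~[atTop] fun k : ℕ => (k : ℝ) ^ α) (hv : ∀ n : ℕ, 1 ≤ n → IsSaddlePoint θ n (v n))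
    {K : ℕ} {G : Set (Fin (K + 1) → ℝ)} (hG : IsOpen G) {g : Fin (K + 1) → ℝ}
    (hg : g ∈ arrivalChamber (K + 1)) (hgG : (fun i => -Real.log (g i)) ∈ G) :
    ENNReal.ofReal (Real.exp (-g (Fin.last K))) ≤
      liminf (fun n => (rescale α (v n) ⁻¹' G).indicator (cellDensity θ α (v n) n (K + 1))
        (fun i => cellIndex α (v n) (g i))) atTop := by
  have hvt := tendsto_saddlePoint hα.le h0 hθ hv
  have hidx := fun i => tendsto_mul_cellIndex α hvt (g i)
  have hpos : ∀ᶠ n in atTop, ∀ i, 0 < cellIndex α (v n) (g i) :=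
    eventually_all.2 fun i => eventually_cellIndex_pos hα hvt (g i)
  -- The indices are eventually positive, so that they can be used as cycle lengths.
  have hcast : ∀ᶠ n in atTop, ∀ i, (((cellIndex α (v n) (g i)).toNat : ℕ) : ℤ) =
      cellIndex α (v n) (g i) :=
    hpos.mono fun n hn i => Int.toNat_of_nonneg (hn i).le
  refine le_of_forall_lt_imp_le_of_dense fun c hc => ?_
  have hctop : c ≠ ⊤ := hc.ne_top
  have hc' := (ENNReal.lt_ofReal_iff_toReal_lt hctop).1 hc
  have hlog : StrictAnti fun i => -Real.log (g i) := fun i j hij =>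
    neg_lt_neg (Real.log_lt_log (hg.1 i) (hg.2 hij))
  have hev := eventually_le_permMeasure hα h0 hθ hv (y := fun i => -Real.log (g i)) hlog
    (m := fun n i => (cellIndex α (v n) (g i)).toNat) (fun i => by
      refine (hidx i).congr' ?_
      filter_upwards [hcast] with n hn
      have : ((((cellIndex α (v n) (g i)).toNat : ℕ) : ℤ) : ℝ) =
          (cellIndex α (v n) (g i) : ℝ) := by rw [hn i]
      rw [← this, Int.cast_natCast]) (r := c.toReal) (by
      rw [neg_neg, Real.exp_log (hg.1 _)]; exact hc')
  have hres : Tendsto (fun n => rescale α (v n) fun i => cellIndex α (v n) (g i)) atTop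
      (𝓝 fun i => -Real.log (g i)) := by
    rw [tendsto_pi_nhds]
    intro i
    refine (hidx i).congr' ?_
    filter_upwards [hvt.eventually self_mem_nhdsWithin] with n (hn : 0 < v n)
    rw [rescale]
    field_simp
  refine le_liminf_of_le (by isBoundedDefault) ?_
  filter_upwards [hev, hcast, hres.eventually (hG.mem_nhds hgG), hvt.eventually self_mem_nhdsWithin]
    with n h1 h2 h3 (hn : 0 < v n)
  have hW : 0 < ∏ i, cellWidth α (v n) (cellIndex α (v n) (g i)) :=
    Finset.prod_pos fun i _ => cellWidth_pos hn _
  simp only [h2] at h1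
  rw [Set.indicator_of_mem (show (fun i => cellIndex α (v n) (g i)) ∈
    rescale α (v n) ⁻¹' G from h3),
    cellDensity, ENNReal.le_div_iff_mul_le (Or.inl (ENNReal.ofReal_pos.2 hW).ne')
      (Or.inl ENNReal.ofReal_ne_top)]
  rw [ENNReal.ofReal_mul ENNReal.toReal_nonneg, ENNReal.ofReal_toReal hctop] at h1
  refine h1.trans (measure_mono fun σ hσ i => ?_)
  rw [hσ i, h2 i]

lemma measurable_neg_log_pi (K : ℕ) : Measurable fun (g : Fin K → ℝ) i => -Real.log (g i) :=
  measurable_pi_lambda _ fun i => (Real.measurable_log.comp (measurable_pi_apply i)).neg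

/-- The lower bound of the portmanteau theorem for open sets, by Fatou's lemma. -/
theorem pi_expMeasure_le_liminf (hα : 0 < α) (h0 : ∀ k : ℕ, 1 ≤ k → 0 ≤ θ k)
    (hθ : θ ~[atTop] fun k : ℕ => (k : ℝ) ^ α) (hv : ∀ n : ℕ, 1 ≤ n → IsSaddlePoint θ n (v n))
    {K : ℕ} {G : Set (Fin (K + 1) → ℝ)} (hG : IsOpen G) :
    Measure.pi (fun _ : Fin (K + 1) => expMeasure 1) {e |
      (fun i => -Real.log (partialSums e i)) ∈ G} ≤
      liminf (fun n => permMeasure θ n {σ | rescaledLongest (K + 1) α (v n)⁻¹ σ ∈ G}) atTop := by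
  have hvt := tendsto_saddlePoint hα.le h0 hθ hv
  set B : Set (Fin (K + 1) → ℝ) := (fun g i => -Real.log (g i)) ⁻¹' G
  have hB : MeasurableSet B := measurable_neg_log_pi (K + 1) hG.measurableSet
  have hBA := hB.inter (measurableSet_arrivalChamber (K + 1))
  -- The density of the law of the rescaled lengths, restricted to `G`.
  set F : ℕ → (Fin (K + 1) → ℝ) → ENNReal := fun n g =>
    (rescale α (v n) ⁻¹' G).indicator (cellDensity θ α (v n) n (K + 1))
      (fun i => cellIndex α (v n) (g i))
  have hFm : ∀ n, Measurable (F n) := fun n =>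
    (Measurable.of_discrete (f :=
      (rescale α (v n) ⁻¹' G).indicator (cellDensity θ α (v n) n (K + 1)))).comp
      (measurable_cellIndex_pi α (v n) (K + 1))
  have horth : orthantVolume (K + 1) = volume.restrict (Set.univ.pi fun _ => Set.Ioi (0 : ℝ)) := by
    rw [orthantVolume, volume_pi, Measure.restrict_pi_pi]
  have hsub : B ∩ arrivalChamber (K + 1) ⊆ Set.univ.pi fun _ => Set.Ioi (0 : ℝ) :=
    fun g hg i _ => hg.2.1 i
  calc Measure.pi (fun _ : Fin (K + 1) => expMeasure 1) (partialSums ⁻¹' B)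
      ≤ ∫⁻ g in B ∩ arrivalChamber (K + 1), ENNReal.ofReal (Real.exp (-g (Fin.last K))) :=
        pi_expMeasure_partialSums_le hB
    _ = ∫⁻ g in B ∩ arrivalChamber (K + 1),
      ENNReal.ofReal (Real.exp (-g (Fin.last K))) ∂(orthantVolume (K + 1)) := by
        rw [horth, Measure.restrict_restrict hBA, Set.inter_eq_left.2 hsub]
    _ ≤ ∫⁻ g in B ∩ arrivalChamber (K + 1),
      liminf (fun n => F n g) atTop ∂(orthantVolume (K + 1)) :=
        setLIntegral_mono' hBA fun g hg => ofReal_le_liminf_cellDensity hα h0 hθ hv hG hg.2 hg.1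
    _ ≤ ∫⁻ g, liminf (fun n => F n g) atTop ∂(orthantVolume (K + 1)) :=
      setLIntegral_le_lintegral _ _
    _ ≤ liminf (fun n => ∫⁻ g, F n g ∂(orthantVolume (K + 1))) atTop := lintegral_liminf_le hFm
    _ = _ := by
        refine liminf_congr ?_
        filter_upwards [hvt.eventually self_mem_nhdsWithin] with n (hn : 0 < v n)
        exact (permMeasure_rescaledLongest_eq θ hn n (K + 1) G).symm

end Fatou

/-! ### Convergence in distribution -/

section Convergence

variable {α : ℝ} {θ : ℕ → ℝ} {v : ℕ → ℝ}

theorem tendstoInDistribution_rescaledLongest (hα : 0 < α) (h0 : ∀ k : ℕ, 1 ≤ k → 0 ≤ θ k)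
    (hθ : θ ~[atTop] fun k : ℕ => (k : ℝ) ^ α) (hv : ∀ n : ℕ, 1 ≤ n → IsSaddlePoint θ n (v n))
    (K N : ℕ) [hP : ∀ n : ℕ, IsProbabilityMeasure (permMeasure θ (N + n))]
    {Ω : Type*} [MeasurableSpace Ω] (μ : Measure Ω) [IsProbabilityMeasure μ]
    (E : Fin K → Ω → ℝ) (hE : iIndepFun E μ) (hlaw : ∀ j, HasLaw (E j) (expMeasure 1) μ) :
    TendstoInDistribution
      (fun (n : ℕ) (σ : Equiv.Perm (Fin (N + n))) => rescaledLongest K α (v (N + n))⁻¹ σ) atTop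
      (fun (ω : Ω) (i : Fin K) => -Real.log (∑ j ∈ Finset.Iic i, E j ω))
      (fun n : ℕ => permMeasure θ (N + n)) μ := by
  have hEm : ∀ j, AEMeasurable (E j) μ := fun j => (hlaw j).aemeasurable
  have hX : ∀ n : ℕ, Measurable fun σ : Equiv.Perm (Fin n) => rescaledLongest K α (v n)⁻¹ σ :=
    fun n => measurable_from_top
  have hZ : AEMeasurable (fun (ω : Ω) (i : Fin K) => -Real.log (∑ j ∈ Finset.Iic i, E j ω)) μ :=
    aemeasurable_pi_lambda _ fun i => (Real.measurable_log.comp_aemeasurable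
      (Finset.aemeasurable_fun_sum _ fun j _ => hEm j)).neg
  refine ⟨fun n => (hX (N + n)).aemeasurable, hZ, ?_⟩
  refine tendsto_of_forall_isOpen_le_liminf' fun G hG => ?_
  change μ.map _ G ≤ liminf (fun n => (permMeasure θ (N + n)).map _ G) atTop
  rw [Measure.map_apply_of_aemeasurable hZ hG.measurableSet]
  simp only [Measure.map_apply (hX _) hG.measurableSet]
  -- For `K = 0` the space is a point; the local law concerns at least one cycle.
  cases K with
  | zero =>
    rcases Set.eq_empty_or_nonempty G with rfl | ⟨z, hz⟩
    · simp
    · have hGu : G = Set.univ := Set.eq_univ_of_forall fun z' => Subsingleton.elim z z' ▸ hz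
      subst hGu
      simp
  | succ K =>
    have hmain := pi_expMeasure_le_liminf hα h0 hθ hv hG
    have hshift : liminf (fun n => permMeasure θ (N + n)
          ((fun σ => rescaledLongest (K + 1) α (v (N + n))⁻¹ σ) ⁻¹' G)) atTop
        = liminf (fun n => permMeasure θ n
          {σ | rescaledLongest (K + 1) α (v n)⁻¹ σ ∈ G}) atTop := by
      rw [← liminf_nat_add
        (fun n => permMeasure θ n {σ | rescaledLongest (K + 1) α (v n)⁻¹ σ ∈ G}) N]
      refine liminf_congr (Eventually.of_forall fun n => ?_)
      rw [add_comm n N]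
      rfl
    rw [hshift]
    refine le_trans (le_of_eq ?_) hmain
    -- Independence identifies the joint law of the `E j` with the product measure.
    have hpi : Measure.pi (fun _ : Fin (K + 1) => expMeasure 1) = μ.map fun ω i => E i ω := by
      rw [(iIndepFun_iff_map_fun_eq_pi_map hEm).1 hE]
      congr 1
      ext1 j
      exact (hlaw j).map_eq.symm
    have hmeas : MeasurableSet {e : Fin (K + 1) → ℝ | (fun i => -Real.log (partialSums e i)) ∈ G} :=
      ((measurable_neg_log_pi (K + 1)).comp (measurePreserving_partialSums (K + 1)).measurable)
        hG.measurableSet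
    rw [hpi, Measure.map_apply_of_aemeasurable (aemeasurable_pi_lambda _ hEm) hmeas]
    rfl

/-- If `E` is exponential of parameter `1`, then `-log E` has the Gumbel distribution. -/
lemma expMeasure_neg_log_le (x : ℝ) :
    expMeasure 1 {ω | -Real.log ω ≤ x} = ENNReal.ofReal (Real.exp (-Real.exp (-x))) := by
  have := isProbabilityMeasure_expMeasure one_pos
  have hcdf : ∀ t, 0 ≤ t → (expMeasure 1).real (Set.Iic t) = 1 - Real.exp (-t) := by
    intro t ht
    rw [← cdf_eq_real, cdf_expMeasure_eq one_pos, if_pos ht, one_mul]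
  have h1 : expMeasure 1 {ω | -Real.log ω ≤ x} = expMeasure 1 (Set.Ioi (Real.exp (-x))) := by
    refine measure_congr ?_
    have hpos : ∀ᵐ ω ∂(expMeasure 1), 0 < ω := by
      rw [ae_iff]
      have h := hcdf 0 le_rfl
      rw [neg_zero, Real.exp_zero, sub_self, measureReal_eq_zero_iff] at h
      convert h using 2
      ext ω
      simp
    have hne : ∀ᵐ ω ∂(expMeasure 1), ω ≠ Real.exp (-x) := by
      have hac : expMeasure 1 ≪ volume := withDensity_absolutelyContinuous _ _
      exact hac.ae_le (Measure.ae_ne volume (Real.exp (-x)))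
    filter_upwards [hpos, hne] with ω hω hωne
    refine propext ?_
    change -Real.log ω ≤ x ↔ Real.exp (-x) < ω
    rw [neg_le, Real.le_log_iff_exp_le hω]
    exact ⟨fun h => lt_of_le_of_ne h hωne.symm, le_of_lt⟩
  rw [h1, ← Set.compl_Iic, prob_compl_eq_one_sub measurableSet_Iic, ← ofReal_measureReal,
    hcdf _ (Real.exp_pos _).le, ← ENNReal.ofReal_one, ← ENNReal.ofReal_sub _ (by
      have := Real.exp_le_one_iff.2 (neg_nonpos.2 (Real.exp_pos (-x)).le); linarith),
    sub_sub_cancel]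

theorem tendsto_longestCycle_gumbel (hα : 0 < α) (h0 : ∀ k : ℕ, 1 ≤ k → 0 ≤ θ k)
    (hθ : θ ~[atTop] fun k : ℕ => (k : ℝ) ^ α) (hv : ∀ n : ℕ, 1 ≤ n → IsSaddlePoint θ n (v n))
    (x : ℝ) :
    Tendsto (fun n : ℕ => (permMeasure θ n).real
        {σ | (1 / (v n)⁻¹) * ((longestCycle 1 σ : ℝ) - (v n)⁻¹ * ell α (v n)⁻¹) ≤ x})
      atTop (𝓝 (Real.exp (-Real.exp (-x)))) := by
  have hE := isProbabilityMeasure_expMeasure one_pos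
  obtain ⟨N, hN⟩ := eventually_atTop.1 (eventually_normConst_pos hα h0 hθ hv)
  have hP : ∀ n, IsProbabilityMeasure (permMeasure θ (N + n)) := fun n =>
    isProbabilityMeasure_permMeasure h0 (hN (N + n) (Nat.le_add_right _ _))
  have hconv := tendstoInDistribution_rescaledLongest hα h0 hθ hv 1 N (expMeasure 1)
    (fun _ => id) (iIndepFun.of_subsingleton) (fun _ => HasLaw.id)
  have hlaw : ∀ S : Set (Fin 1 → ℝ), MeasurableSet S → (expMeasure 1).map
      (fun (ω : ℝ) (i : Fin 1) => -Real.log (∑ j ∈ Finset.Iic i, id ω)) S =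
      expMeasure 1 {ω | (fun _ => -Real.log ω) ∈ S} := by
    intro S hS
    rw [Measure.map_apply_of_aemeasurable hconv.aemeasurable_limit hS]
    congr 1
    ext ω
    simp
  have hS : IsClosed {z : Fin 1 → ℝ | z 0 ≤ x} := isClosed_le (continuous_apply 0) continuous_const
  have hfront : (expMeasure 1).map
      (fun (ω : ℝ) (i : Fin 1) => -Real.log (∑ j ∈ Finset.Iic i, id ω))
        (frontier {z : Fin 1 → ℝ | z 0 ≤ x}) = 0 := by
    refine measure_mono_null (frontier_le_subset_eq (continuous_apply 0) continuous_const) ?_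
    rw [hlaw _ (measurableSet_eq_fun (measurable_pi_apply 0) measurable_const)]
    have hac : expMeasure 1 ≪ volume := withDensity_absolutelyContinuous _ _
    -- The junk values `log 0 = 0` and `log (-ω) = log ω` add two more points to the level set.
    refine measure_mono_null (t := {Real.exp (-x), -Real.exp (-x), 0}) (fun ω hω => ?_)
      (hac (Set.Finite.measure_zero (Set.toFinite _) _))
    have hω' : -Real.log ω = x := hω
    rcases eq_or_ne ω 0 with rfl | h
    · simp
    · have habs : |ω| = Real.exp (-x) := by
        rw [← hω', neg_neg, Real.exp_log_eq_abs h]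
      rcases abs_eq (Real.exp_pos _).le |>.1 habs with h | h <;> simp [h]
  have hlim := ProbabilityMeasure.tendsto_measure_of_null_frontier_of_tendsto' hconv.tendsto
    (E := {z : Fin 1 → ℝ | z 0 ≤ x}) hfront
  have hlimit : (expMeasure 1).map (fun (ω : ℝ) (i : Fin 1) =>
      -Real.log (∑ j ∈ Finset.Iic i, id ω)) {z : Fin 1 → ℝ | z 0 ≤ x} =
      ENNReal.ofReal (Real.exp (-Real.exp (-x))) := by
    rw [hlaw _ hS.measurableSet]
    exact expMeasure_neg_log_le x
  change Tendsto (fun n => (permMeasure θ (N + n)).map _ _) atTop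
    (𝓝 ((expMeasure 1).map _ _)) at hlim
  rw [hlimit] at hlim
  have hreal := (ENNReal.tendsto_toReal ENNReal.ofReal_ne_top).comp hlim
  rw [ENNReal.toReal_ofReal (Real.exp_pos _).le] at hreal
  rw [← tendsto_add_atTop_iff_nat N]
  refine hreal.congr fun n => ?_
  rw [add_comm n N]
  simp only [Function.comp_apply]
  rw [Measure.map_apply measurable_from_top hS.measurableSet]
  rfl

end Convergence

end LongCycles

theorem theorem1p1 (α : ℝ) (hα : 0 < α) (θ : ℕ → ℝ) (hθ_nonneg : ∀ k : ℕ, 1 ≤ k → 0 ≤ θ k)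
    (hθ : θ ~[atTop] fun k : ℕ => (k : ℝ) ^ α) :
    -- existence and uniqueness of `v_n`
    (∀ n : ℕ, 1 ≤ n → ∃! v : ℝ, LongCycles.IsSaddlePoint θ n v) ∧
    ∀ v : ℕ → ℝ, (∀ n : ℕ, 1 ≤ n → LongCycles.IsSaddlePoint θ n (v n)) →
      -- the scale `n* = 1 / v_n`
      ((fun n : ℕ => (v n)⁻¹) ~[atTop]
        fun n : ℕ => ((n : ℝ) / Real.Gamma (α + 1)) ^ (1 / (1 + α))) ∧
      -- joint convergence in distribution of the `K` longest cycles under `ℙ_Θ`, which is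
      -- a probability measure for all large `n`
      (∀ (K : ℕ) {Ω : Type*} [MeasurableSpace Ω] (μ : Measure Ω) [IsProbabilityMeasure μ]
        (E : Fin K → Ω → ℝ), iIndepFun E μ → (∀ j, HasLaw (E j) (expMeasure 1) μ) →
        ∃ (N : ℕ) (_ : ∀ n : ℕ, IsProbabilityMeasure (LongCycles.permMeasure θ (N + n))),
          TendstoInDistribution
            (fun (n : ℕ) (σ : Equiv.Perm (Fin (N + n))) =>
              LongCycles.rescaledLongest K α (v (N + n))⁻¹ σ)
            atTop
            (fun (ω : Ω) (i : Fin K) => -Real.log (∑ j ∈ Finset.Iic i, E j ω))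
            (fun n : ℕ => LongCycles.permMeasure θ (N + n)) μ) ∧
      -- the Gumbel limit of the longest cycle
      (∀ x : ℝ, Tendsto
        (fun n : ℕ => (LongCycles.permMeasure θ n).real
          {σ | (1 / (v n)⁻¹) * ((LongCycles.longestCycle 1 σ : ℝ)
            - (v n)⁻¹ * LongCycles.ell α (v n)⁻¹) ≤ x})
        atTop (𝓝 (Real.exp (-Real.exp (-x))))) := by
  refine ⟨fun n hn => LongCycles.existsUnique_isSaddlePoint hα.le hθ_nonneg hθ hn, fun v hv =>
    ⟨LongCycles.inv_saddlePoint_isEquivalent hα.le hθ_nonneg hθ hv, ?_,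
      LongCycles.tendsto_longestCycle_gumbel hα hθ_nonneg hθ hv⟩⟩
  intro K Ω _ μ _ E hE hlaw
  obtain ⟨N, hN⟩ := eventually_atTop.1 (LongCycles.eventually_normConst_pos hα hθ_nonneg hθ hv)
  have hP : ∀ n, IsProbabilityMeasure (LongCycles.permMeasure θ (N + n)) := fun n =>
    LongCycles.isProbabilityMeasure_permMeasure hθ_nonneg (hN (N + n) (Nat.le_add_right _ _))
  exact ⟨N, hP, LongCycles.tendstoInDistribution_rescaledLongest hα hθ_nonneg hθ hv K N μ E hE hlaw⟩
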